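/- **Setting.** For $\mathbf W=(\mathbf w_1,\dots,\mathbf w_m)\in\mathbb R^{d\times m}$ and $\mathbf a\in\{-1,1\}^m$ let $f(\mathbf x;\mathbf W)=\frac1{\sqrt m}\sum_{r=1}^m a_r\,\sigma(\mathbf w_r^\top\mathbf x)$ with $\sigma(z)=\max(0,z)$. Initialize independently $\mathbf w_r(0)\sim\mathcal N(\mathbf 0,\kappa^2\mathbf I_d)$ and $a_r\sim\mathrm{unif}\{-1,1\}$, where $0<\kappa\le 1$. Let $(\mathbf x_j,y_j)_{j=1}^n$ be training data in $\mathbb R^d\times\mathbb R$ with $\|\mathbf x_j\|_2=1$, $|y_j|\le1$. Only $\mathbf W$ is trained, by the gradient flow $$\frac{d\mathbf W(t)}{dt}=\sum_{j=1}^n\bigl(y_j-f(\mathbf x_j;\mathbf W(t))\bigr)\frac{\partial f(\mathbf x_j;\mathbf W(t))}{\partial\mathbf W}-\lambda(\mathbf W(t)-\mathbf W(0))$$ of the loss $\frac12\sum_j(f(\mathbf x_j;\mathbf W)-y_j)^2+\frac\lambda2\|\mathbf W-\mathbf W(0)\|_F^2$; its solutions are locally absolutely continuous and satisfy the equation for almost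 every $t\geq 0$, with $\sigma'(0)$ allowed to take any value in $[0,1]$. Put $f_{nn}(\mathbf x)=\lim_{t\to\infty}f(\mathbf x;\mathbf W(t))$. Let $$K^\infty(\mathbf x,\mathbf x')=\mathbb E_{\mathbf w\sim\mathcal N(\mathbf 0,\mathbf I_d)}\bigl[\mathbf x^\top\mathbf x'\,\mathbb I\{\mathbf w^\top\mathbf x\ge0,\ \mathbf w^\top\mathbf x'\ge0\}\bigr],\qquad f_{ntk}(\mathbf x)=\bigl(K^\infty(\mathbf x,\mathbf x_j)\bigr)_j^\top(\mathbf K_{tr}+\lambda\mathbf I_n)^{-1}(y_j)_j,$$ with $\mathbf K_{tr}=(K^\infty(\mathbf x_j,\mathbf x_k))_{j,k}$. Let $f_{nn}^{\backslash i},f_{ntk}^{\backslash i}$ be the predictors obtained in the same way, with the same $\lambda$ and from the same initialization, after removing $(\mathbf x_i,y_i)$ from the data. For a test point $(\mathbf x_{te},y_{te})$ and $\bullet\in\{nn,ntk\}$ put $$\mathcal I_\bullet(\mathbf x_i,\mathbf x_{te})=\tfrac12\bigl(f_\bullet^{\backslash i}(\mathbf x_{te})-y_{te}\bigr)^2-\tfrac12\bigl(f_\bullet(\mathbf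 x_{te})-y_{te}\bigr)^2 .$$ **Theorem.** For all $c_1,c_2,C>0$ there is $K>0$, depending only on $c_1,c_2,C$, such that the following holds for all $n,d,m$, all training data as above, and all $\epsilon>0$, $\delta\in(0,1)$, $\kappa\in(0,1]$, $\lambda$ with $$0<\lambda<n^{1/2},\qquad \kappa\le c_1\frac{\sqrt\delta\,\lambda\,\epsilon}{n},\qquad m\ge c_2\,\frac{n^8}{\kappa^2\epsilon^2\delta^4\lambda^6}.$$ Suppose that $|f_{ntk}(\mathbf x)|<C$ for all $\|\mathbf x\|_2=1$. Then for every training point $\mathbf x_i$ and every test point with $\|\mathbf x_{te}\|_2=1$, $|y_{te}|\le1$, with probability at least $1-\delta$ over the random initialization: whenever $|f_{nn}(\mathbf x)|<C$ for all $\|\mathbf x\|_2=1$, $$|\mathcal I_{nn}(\mathbf x_i,\mathbf x_{te})-\mathcal I_{ntk}(\mathbf x_i,\mathbf x_{te})|\le K\epsilon .$$ -/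

import Mathlib

open MeasureTheory ProbabilityTheory Filter Topology

noncomputable section

namespace WideReLU

/-- Hidden-layer weights `W = (w_1, …, w_m)`, each `w_r ∈ ℝ^d` with the Euclidean norm. -/
abbrev Weights (m d : ℕ) : Type := Fin m → EuclideanSpace ℝ (Fin d)

/-- The two-layer ReLU network `f(x; W) = (1/√m) ∑_r a_r max(0, ⟨w_r, x⟩)`. -/
def network {m d : ℕ} (a : Fin m → ℝ) (W : Weights m d) (x : EuclideanSpace ℝ (Fin d)) : ℝ :=
  (1 / Real.sqrt m) * ∑ r, a r * max 0 (inner ℝ (W r) x)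

/-- The generalized derivative of `z ↦ max(0, z)`: `{1}` for `z > 0`, `{0}` for `z < 0` and
`[0, 1]` at the kink `z = 0` (this contains every convention for the derivative at `0`). -/
def reluDeriv (z : ℝ) : Set ℝ :=
  {g | 0 ≤ g ∧ g ≤ 1 ∧ (0 < z → g = 1) ∧ (z < 0 → g = 0)}

/-- The admissible velocities at `W` of the gradient flow of the regularized square loss
`½ ∑_i (f(x_i; W) - y_i)² + (λ/2) ‖W - W₀‖_F²`, that is
`∑_i (y_i - f(x_i; W)) ∂f(x_i; W)/∂W - λ (W - W₀)`, where
`∂f(x; W)/∂w_r = (1/√m) a_r σ'(⟨w_r, x⟩) x`.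
The training points are indexed by an arbitrary finite type, possibly empty. -/
def flowVelocities {ι : Type} [Fintype ι] {m d : ℕ} (x : ι → EuclideanSpace ℝ (Fin d))
    (y : ι → ℝ) (lam : ℝ) (a : Fin m → ℝ) (W₀ W : Weights m d) : Set (Weights m d) :=
  {V | ∃ g : ι → Fin m → ℝ, (∀ i r, g i r ∈ reluDeriv (inner ℝ (W r) (x i))) ∧
    ∀ r, V r = (∑ i, ((y i - network a W (x i)) * ((1 / Real.sqrt m) * a r * g i r)) • x i)
      - lam • (W r - W₀ r)}

/-- `W` is a trajectory of the gradient flow started at `W₀`: it is locally absolutely continuous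
on `[0, ∞)` and satisfies the differential equation at almost every time. -/
structure IsGradientFlow {ι : Type} [Fintype ι] {m d : ℕ} (x : ι → EuclideanSpace ℝ (Fin d))
    (y : ι → ℝ) (lam : ℝ) (a : Fin m → ℝ) (W₀ : Weights m d) (W : ℝ → Weights m d) : Prop where
  init : W 0 = W₀
  absCont : ∀ T : ℝ, 0 < T → AbsolutelyContinuousOnInterval W 0 T
  flow : ∀ᵐ t ∂(volume.restrict (Set.Ioi (0 : ℝ))),
    ∃ V ∈ flowVelocities x y lam a W₀ (W t), HasDerivAt W V t

/-- `f` is the predictor of the network fully trained from `W₀` on the data `(x, y)`: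
`f(z) = lim_{t → ∞} f(z; W(t))` along a trajectory of the gradient flow. -/
def IsTrainedNetwork {ι : Type} [Fintype ι] {m d : ℕ} (x : ι → EuclideanSpace ℝ (Fin d))
    (y : ι → ℝ) (lam : ℝ) (a : Fin m → ℝ) (W₀ : Weights m d)
    (f : EuclideanSpace ℝ (Fin d) → ℝ) : Prop :=
  ∃ W : ℝ → Weights m d, IsGradientFlow x y lam a W₀ W ∧
    ∀ z, Tendsto (fun t => network a (W t) z) atTop (𝓝 (f z))

/-- The neural tangent kernel
`K(x, x') = 𝔼_{w ∼ N(0, I_d)} [⟨x, x'⟩ 1{⟨w, x⟩ ≥ 0, ⟨w, x'⟩ ≥ 0}]`. -/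
def ntk {d : ℕ} (x x' : EuclideanSpace ℝ (Fin d)) : ℝ :=
  ∫ w, {w : EuclideanSpace ℝ (Fin d) | 0 ≤ inner ℝ w x ∧ 0 ≤ inner ℝ w x'}.indicator
    (fun _ => inner ℝ x x') w ∂(stdGaussian (EuclideanSpace ℝ (Fin d)))

open Matrix in
/-- The NTK ridge regression predictor `f_ntk(z) = K_z^⊤ (K_tr + λ I)⁻¹ y`. -/
def ntkPredictor {ι : Type} [Fintype ι] [DecidableEq ι] {d : ℕ}
    (x : ι → EuclideanSpace ℝ (Fin d)) (y : ι → ℝ) (lam : ℝ)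
    (z : EuclideanSpace ℝ (Fin d)) : ℝ :=
  (fun i => ntk z (x i)) ⬝ᵥ
    (((Matrix.of fun i j => ntk (x i) (x j)) + lam • (1 : Matrix ι ι ℝ))⁻¹ *ᵥ y)

/-- The data with the `i`-th point removed. -/
def leaveOut {n : ℕ} {α : Type} (i : Fin n) (v : Fin n → α) : {j : Fin n // j ≠ i} → α :=
  fun j => v j

/-- The influence of a training point on the test loss at a test point with label `yte`, where
`p` is the prediction there after training on all points and `pLoo` after the removal. -/
def influence (pLoo p yte : ℝ) : ℝ :=
  (1 / 2) * (pLoo - yte) ^ 2 - (1 / 2) * (p - yte) ^ 2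

/-- The law of the random initialization `(a, W(0))`: all `a_r` and `w_r(0)` are independent,
`a_r` is uniform on `{-1, 1}` and `w_r(0) ∼ N(0, κ² I_d)`. -/
def initLaw (m d : ℕ) (kappa : ℝ) : Measure ((Fin m → ℝ) × Weights m d) :=
  (Measure.pi fun _ => uniformOn ({-1, 1} : Set ℝ)).prod
    (Measure.pi fun _ => (stdGaussian (EuclideanSpace ℝ (Fin d))).map fun w => kappa • w)

end WideReLU

end

/-! An influence is a difference of squared errors, so `abs_influence_sub_le` reduces the claim, for
the full and the reduced data alike, to one estimate: the error of the network against ridge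
regression, times the size of the two predictions, is O(ε). The sizes are bounded a priori, at order
√(n/λ) times one plus the size of the initial outputs, by the energy estimate for the flow and by
the norm of the ridge weights.

The error is found without solving the dynamics. The regularized loss decreases
(`IsGradientFlow.loss_le`), so the residuals stay bounded, and the pull towards the initial weights
confines each weight, for all time, to a ball whose radius R is of order n/(λ√m) up to the same
factor (`IsGradientFlow.norm_weight_sub_le`). Only neurons with |⟨w_r(0), z⟩| ≤ R can change
activation at z, which is a fraction of order R/κ. Hence the velocity of the prediction at z is that
of kernel regression with the NTK, up to a small drift (`abs_velocity_sub_le`). The predictions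
converge, so the kernel velocity converges too, and its limit cannot exceed the drift
(`LocAC.abs_limit_le`). This gives approximate normal equations ∑ K(z, x_k)(y_k − f(x_k)) = λ(f(z) −
f(z; W(0))) + η(z). Pairing those at the training points with the ridge weights q = (K_tr + λ)⁻¹K_z,
of norm at most λ^{-1/2}, expresses f − f_ntk exactly through the initial outputs and η
(`IsTrainedNetwork.abs_sub_ntkPredictor_le`).

Randomness enters only through three sums over the training and test points, controlled by Markov's
inequality in `exists_good_event`: fourth powers of initial outputs, flip fractions, and squared
kernel errors. The fourth moment makes the initial outputs of order κτ with τ of order δ^{-1/4}. The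
final product contains (n/λ)κτ(1 + κτ) ≤ 2(n/λ)κτ², and τ² of order δ^{-1/2} is exactly what the
condition on κ absorbs; the width condition absorbs the drift. -/

namespace WideReLU

/-! ### Absolutely continuous functions and differential inequalities. -/

section AbsolutelyContinuous

variable {X Y : Type*} [PseudoMetricSpace X] [PseudoMetricSpace Y]

theorem absolutelyContinuousOnInterval_lipschitz_comp {K : NNReal} {L : X → Y}
    (hL : LipschitzWith K L) {f : ℝ → X} {a b : ℝ} (hf : AbsolutelyContinuousOnInterval f a b) :
    AbsolutelyContinuousOnInterval (fun t => L (f t)) a b := by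
  unfold AbsolutelyContinuousOnInterval at *
  refine squeeze_zero (fun t => ?_) (fun t => ?_) (by simpa using hf.const_mul (K : ℝ))
  · exact Finset.sum_nonneg fun i _ => dist_nonneg
  · rw [Finset.mul_sum]
    exact Finset.sum_le_sum fun i _ => hL.dist_le_mul _ _

theorem absolutelyContinuousOnInterval_const (c : X) (a b : ℝ) :
    AbsolutelyContinuousOnInterval (fun _ => c) a b :=
  LipschitzOnWith.absolutelyContinuousOnInterval (K := 0)
    ((LipschitzWith.const c).lipschitzOnWith)

theorem absolutelyContinuousOnInterval_sum {ι : Type*} (s : Finset ι) {f : ι → ℝ → ℝ} {a b : ℝ}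
    (hf : ∀ i ∈ s, AbsolutelyContinuousOnInterval (f i) a b) :
    AbsolutelyContinuousOnInterval (fun t => ∑ i ∈ s, f i t) a b := by
  classical
  induction s using Finset.induction_on with
  | empty => simpa using absolutelyContinuousOnInterval_const (0 : ℝ) a b
  | insert i s hi ih =>
    simp only [Finset.sum_insert hi]
    exact (hf i (by simp)).fun_add (ih fun j hj => hf j (by simp [hj]))

/-- Local absolute continuity on `[0, ∞)`. -/
def LocAC (f : ℝ → X) : Prop := ∀ T : ℝ, 0 < T → AbsolutelyContinuousOnInterval f 0 T

theorem LocAC.mono {f : ℝ → X} (hf : LocAC f) {a b : ℝ} (ha : 0 ≤ a) (hb : 0 ≤ b) :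
    AbsolutelyContinuousOnInterval f a b := by
  refine (hf (max a b + 1) (by positivity)).mono ?_
  rw [Set.uIcc_of_le (show (0 : ℝ) ≤ max a b + 1 by positivity)]
  intro t ht
  rw [Set.mem_uIcc] at ht
  have h1 := le_max_left a b
  have h2 := le_max_right a b
  constructor <;> rcases ht with h | h <;> linarith [h.1, h.2]

theorem LocAC.ae_differentiableAt {f : ℝ → ℝ} (hf : LocAC f) :
    ∀ᵐ t ∂(volume.restrict (Set.Ioi (0 : ℝ))), DifferentiableAt ℝ f t := by
  rw [ae_restrict_iff' measurableSet_Ioi]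
  have h : ∀ n : ℕ, ∀ᵐ t : ℝ, t ∈ Set.uIcc 0 ((n : ℝ) + 1) → DifferentiableAt ℝ f t :=
    fun n => (hf _ (by positivity)).ae_differentiableAt
  filter_upwards [ae_all_iff.2 h] with t ht h0
  obtain ⟨n, hn⟩ := exists_nat_ge t
  refine ht n ?_
  rw [Set.uIcc_of_le (by positivity)]
  exact ⟨le_of_lt h0, by linarith⟩

/-- A bound on the derivative almost everywhere bounds the increments. -/
theorem LocAC.sub_le {f : ℝ → ℝ} (hf : LocAC f) {a b M : ℝ} (ha : 0 ≤ a) (hab : a ≤ b)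
    (h : ∀ᵐ t ∂(volume.restrict (Set.Ioi (0 : ℝ))), a ≤ t → ∃ D ≤ M, HasDerivAt f D t) :
    f b - f a ≤ M * (b - a) := by
  have hac := hf.mono ha (ha.trans hab)
  rw [← hac.integral_deriv_eq_sub]
  have hc : ∫ _ in a..b, M = M * (b - a) := by simp [mul_comm]
  rw [← hc]
  refine intervalIntegral.integral_mono_ae_restrict hab hac.intervalIntegrable_deriv
    (by simp) ?_
  rw [ae_restrict_iff' measurableSet_Ioi] at h
  rw [Filter.EventuallyLE, ae_restrict_iff' measurableSet_Icc]
  have h0 : ∀ᵐ t : ℝ, t ≠ 0 := by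
    simp [ae_iff]
  filter_upwards [h, h0] with t ht ht0 hm
  obtain ⟨D, hD, hd⟩ := ht (lt_of_le_of_ne (ha.trans hm.1) (Ne.symm ht0)) hm.1
  rw [hd.deriv]
  exact hD

theorem LocAC.le_zero {f : ℝ → ℝ} (hf : LocAC f)
    (h : ∀ᵐ t ∂(volume.restrict (Set.Ioi (0 : ℝ))), ∃ D ≤ 0, HasDerivAt f D t) {t : ℝ}
    (ht : 0 ≤ t) : f t ≤ f 0 := by
  have := hf.sub_le (M := 0) le_rfl ht (h.mono fun t h _ => h)
  linarith

/-- If `f` converges and `f' = A + η` with `A` convergent and `|η| ≤ β` then `|lim A| ≤ β`. -/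
theorem LocAC.limit_le {f A : ℝ → ℝ} (hf : LocAC f) {F L β : ℝ}
    (hlim : Tendsto f atTop (𝓝 F)) (hA : Tendsto A atTop (𝓝 L))
    (h : ∀ᵐ t ∂(volume.restrict (Set.Ioi (0 : ℝ))), ∃ D, |D - A t| ≤ β ∧ HasDerivAt f D t) :
    L ≤ β := by
  by_contra! hlt
  obtain ⟨ε, hε, hεL⟩ : ∃ ε > 0, β + 3 * ε ≤ L := ⟨(L - β) / 3, by linarith, by linarith⟩
  have h1 : ∀ᶠ t in atTop, L - ε < A t := hA.eventually (lt_mem_nhds (by linarith))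
  have h2 : ∀ᶠ t in atTop, |f t - F| < 1 := by
    simpa [Real.dist_eq] using Metric.tendsto_nhds.1 hlim 1 one_pos
  obtain ⟨a, ha⟩ := eventually_atTop.1 (h1.and (h2.and (eventually_ge_atTop 0)))
  have ha0 : 0 ≤ a := (ha a le_rfl).2.2
  have hg : LocAC fun t => - f t := fun T hT => (hf T hT).fun_neg
  -- If β < L, then f' ≥ ε almost everywhere past a, so f gains at least 3 over a length 3/ε; being
  -- within 1 of F at both ends allows less than 2.
  have := hg.sub_le (M := -ε) (b := a + 3 / ε) ha0 (by have : 0 < 3 / ε := by positivity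
                                                       linarith) (by
    filter_upwards [h] with t ⟨D, hD, hd⟩ hat
    refine ⟨-D, ?_, hd.neg⟩
    have := (ha t hat).1
    have := neg_le_of_abs_le hD
    linarith)
  have e : -ε * (a + 3 / ε - a) = -3 := by field_simp; ring
  rw [e] at this
  have b1 := abs_lt.1 (ha a le_rfl).2.1
  have b2 := abs_lt.1 (ha (a + 3 / ε) (by have : 0 < 3 / ε := by positivity
                                          linarith)).2.1
  linarith [b1.1, b1.2, b2.1, b2.2]

theorem LocAC.abs_limit_le {f A : ℝ → ℝ} (hf : LocAC f) {F L β : ℝ}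
    (hlim : Tendsto f atTop (𝓝 F)) (hA : Tendsto A atTop (𝓝 L))
    (h : ∀ᵐ t ∂(volume.restrict (Set.Ioi (0 : ℝ))), ∃ D, |D - A t| ≤ β ∧ HasDerivAt f D t) :
    |L| ≤ β := by
  rw [abs_le']
  refine ⟨hf.limit_le hlim hA h, ?_⟩
  have hg : LocAC fun t => - f t := fun T hT => (hf T hT).fun_neg
  refine hg.limit_le hlim.neg hA.neg (h.mono ?_)
  rintro t ⟨D, hD, hd⟩
  refine ⟨-D, ?_, hd.neg⟩
  rwa [← abs_neg, show -(-D - -A t) = D - A t by ring]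

/-- The differential inequality `q' ≤ λ (c - q)` keeps `q` below `c`. -/
theorem LocAC.le_of_deriv_le {q : ℝ → ℝ} (hq : LocAC q) {lam c : ℝ} (h0 : q 0 ≤ c)
    (h : ∀ᵐ t ∂(volume.restrict (Set.Ioi (0 : ℝ))),
      ∃ D ≤ lam * (c - q t), HasDerivAt q D t) {t : ℝ} (ht : 0 ≤ t) : q t ≤ c := by
  have hexp : ∀ s : ℝ, HasDerivAt (fun s => Real.exp (lam * s)) (Real.exp (lam * s) * lam) s := by
    intro s
    simpa using ((hasDerivAt_id s).const_mul lam).exp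
  have hE : LocAC fun s => Real.exp (lam * s) := fun T _ =>
    ContDiffOn.absolutelyContinuousOnInterval
      (((contDiff_const.mul contDiff_id).exp).contDiffOn)
  -- Integrating factor: e^{λs}(q − c) is nonincreasing.
  have hg : LocAC fun s => Real.exp (lam * s) * (q s - c) := fun T hT =>
    (hE T hT).fun_mul ((hq T hT).fun_sub (absolutelyContinuousOnInterval_const c 0 T))
  have := hg.le_zero (by
    filter_upwards [h] with s ⟨D, hD, hd⟩
    refine ⟨_, ?_, (hexp s).mul (hd.sub_const c)⟩
    have : Real.exp (lam * s) * lam * (q s - c) + Real.exp (lam * s) * D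
        = Real.exp (lam * s) * (D - lam * (c - q s)) := by ring
    rw [this]
    exact mul_nonpos_of_nonneg_of_nonpos (Real.exp_pos _).le (by linarith)) ht
  have h1 : Real.exp (lam * t) * (q t - c) ≤ 0 := by
    refine this.trans ?_
    simp only [mul_zero, Real.exp_zero, one_mul]
    linarith
  have := Real.exp_pos (lam * t)
  by_contra! hlt
  have := mul_pos this (sub_pos.2 hlt)
  linarith

end AbsolutelyContinuous

/-! ### Chain rule through the ReLU. -/

section ReluChainRule

/-- At the kink every choice of g works: if φ(t) = 0, both max(0, φ) and max(0, φ) − φ have a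
minimum at t, so both derivatives vanish and φ' = 0. Differentiability of the composite is available
at almost every time from absolute continuity. -/
theorem hasDerivAt_relu {φ : ℝ → ℝ} {φ' t g : ℝ} (hφ : HasDerivAt φ φ' t)
    (hd : DifferentiableAt ℝ (fun s => max 0 (φ s)) t) (hg : g ∈ reluDeriv (φ t)) :
    HasDerivAt (fun s => max 0 (φ s)) (g * φ') t := by
  rcases lt_trichotomy (φ t) 0 with h | h | h
  · rw [hg.2.2.2 h, zero_mul]
    refine (hasDerivAt_const t (0 : ℝ)).congr_of_eventuallyEq ?_
    filter_upwards [hφ.continuousAt.eventually (gt_mem_nhds h)] with s hs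
    exact max_eq_left (le_of_lt hs)
  · have hmin : IsLocalMin (fun s => max 0 (φ s)) t := by
      refine Eventually.of_forall fun s => ?_
      simp [h]
    have h0 := hmin.hasDerivAt_eq_zero hd.hasDerivAt
    have hmin' : IsLocalMin (fun s => max 0 (φ s) - φ s) t := by
      refine Eventually.of_forall fun s => ?_
      simp [h]
    have h1 := hmin'.hasDerivAt_eq_zero (hd.hasDerivAt.sub hφ)
    have h2 : φ' = 0 := by linarith
    have := hd.hasDerivAt
    rw [h0] at this
    simpa [h2] using this
  · rw [hg.2.2.1 h, one_mul]
    refine hφ.congr_of_eventuallyEq ?_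
    filter_upwards [hφ.continuousAt.eventually (lt_mem_nhds h)] with s hs
    exact max_eq_right (le_of_lt hs)

theorem mul_eq_relu {g z : ℝ} (hg : g ∈ reluDeriv z) : g * z = max 0 z := by
  rcases lt_trichotomy z 0 with h | h | h
  · rw [hg.2.2.2 h, zero_mul, max_eq_left h.le]
  · simp [h]
  · rw [hg.2.2.1 h, one_mul, max_eq_right h.le]

/-- The indicator of the open-or-closed half line, a selection of `reluDeriv`. -/
noncomputable def step (z : ℝ) : ℝ := if 0 ≤ z then 1 else 0

theorem step_mem (z : ℝ) : step z ∈ reluDeriv z := by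
  unfold step
  split_ifs with h
  · exact ⟨zero_le_one, le_rfl, fun _ => rfl, fun h' => absurd h (not_le.2 h')⟩
  · exact ⟨le_rfl, zero_le_one, fun h' => absurd h'.le h, fun _ => rfl⟩

end ReluChainRule

end WideReLU

/-! ### Activation flips and the Lipschitz bound of the network. -/

namespace WideReLU

/-- `1` on the neurons whose activation at `z` may change when the weight moves by `R`. -/
noncomputable def flip (R z : ℝ) : ℝ := if |z| ≤ R then 1 else 0

theorem flip_nonneg (R z : ℝ) : 0 ≤ flip R z := by
  unfold flip; split_ifs <;> norm_num

theorem abs_sub_step_le {R z z₀ g : ℝ} (hg : g ∈ reluDeriv z) (h : |z - z₀| ≤ R) :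
    |g - step z₀| ≤ flip R z₀ := by
  have hg0 := hg.1
  have hg1 := hg.2.1
  unfold flip step
  obtain ⟨h1, h2⟩ := abs_le.1 h
  split_ifs with hp hf hf
  · rw [abs_le]; constructor <;> linarith
  · rw [abs_of_nonneg hp] at hf
    rw [hg.2.2.1 (by linarith)]; simp
  · rw [abs_le]; constructor <;> linarith
  · rw [abs_of_neg (not_le.1 hp)] at hf
    rw [hg.2.2.2 (by linarith)]; simp

/-- A wrong slope matters only where |z₀| ≤ R, and there it is multiplied by z₀, which gains a
further factor R. -/
theorem abs_mul_sub_relu_le {R z z₀ g : ℝ} (hg : g ∈ reluDeriv z) (h : |z - z₀| ≤ R) :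
    |g * z₀ - max 0 z₀| ≤ flip R z₀ * R := by
  rw [← mul_eq_relu (step_mem z₀), ← sub_mul, abs_mul]
  have h1 := abs_sub_step_le hg h
  by_cases hf : |z₀| ≤ R
  · exact mul_le_mul h1 hf (abs_nonneg _) (flip_nonneg _ _)
  · have : flip R z₀ = 0 := by simp [flip, hf]
    rw [this] at h1 ⊢
    rw [le_antisymm h1 (abs_nonneg _)]
    simp

variable {m d : ℕ}

/-- The fraction of neurons whose preactivation at `z` is at most `R` in absolute value. -/
noncomputable def flipFraction (W₀ : Weights m d) (R : ℝ) (z : EuclideanSpace ℝ (Fin d)) : ℝ :=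
  (1 / m) * ∑ r, flip R (inner ℝ (W₀ r) z)

theorem flipFraction_nonneg (W₀ : Weights m d) (R : ℝ) (z : EuclideanSpace ℝ (Fin d)) :
    0 ≤ flipFraction W₀ R z :=
  mul_nonneg (by positivity) (Finset.sum_nonneg fun _ _ => flip_nonneg _ _)

/-- The tangent kernel of the finite network at `W₀`. -/
noncomputable def empKernel (W₀ : Weights m d) (z z' : EuclideanSpace ℝ (Fin d)) : ℝ :=
  (1 / m) * ∑ r, step (inner ℝ (W₀ r) z) * step (inner ℝ (W₀ r) z') * inner ℝ z z'

/-- The normalization 1/√m is what Cauchy–Schwarz over the m neurons costs, so the Lipschitz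
constant in the Frobenius norm is 1. -/
theorem abs_network_sub_le {a : Fin m → ℝ} (ha : ∀ r, |a r| = 1) (W W' : Weights m d)
    (z : EuclideanSpace ℝ (Fin d)) (hz : ‖z‖ = 1) :
    |network a W z - network a W' z| ≤ Real.sqrt (∑ r, ‖W r - W' r‖ ^ 2) := by
  have h1 : |network a W z - network a W' z| ≤ (1 / Real.sqrt m) * ∑ r, ‖W r - W' r‖ := by
    unfold network
    rw [← mul_sub, ← Finset.sum_sub_distrib, abs_mul, abs_of_nonneg (by positivity)]
    refine mul_le_mul_of_nonneg_left ((Finset.abs_sum_le_sum_abs _ _).trans ?_) (by positivity)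
    refine Finset.sum_le_sum fun r _ => ?_
    rw [← mul_sub, abs_mul, ha r, one_mul]
    have h2 : |max 0 (inner ℝ (W r) z) - max 0 (inner ℝ (W' r) z)|
        ≤ |inner ℝ (W r) z - inner ℝ (W' r) z| := by
      simpa using abs_max_sub_max_le_max (0 : ℝ) (inner ℝ (W r) z) 0 (inner ℝ (W' r) z)
    refine h2.trans ?_
    rw [← inner_sub_left]
    simpa [hz] using abs_real_inner_le_norm (W r - W' r) z
  refine h1.trans (Real.le_sqrt_of_sq_le ?_)
  have h4 : (∑ r, ‖W r - W' r‖) ^ 2 ≤ m * ∑ r, ‖W r - W' r‖ ^ 2 := by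
    simpa using sq_sum_le_card_mul_sum_sq (s := (Finset.univ : Finset (Fin m)))
      (f := fun r => ‖W r - W' r‖)
  rw [mul_pow, div_pow, one_pow, Real.sq_sqrt (by positivity)]
  rcases Nat.eq_zero_or_pos m with h0 | h0
  · subst h0; simp
  · have : (0 : ℝ) < m := by exact_mod_cast h0
    rw [one_div, inv_mul_le_iff₀ this]
    exact h4

/-! ### Gradient flow: energy, weight displacement, and velocity of the predictions. -/

section Flow

theorem hasDerivAt_inner_weight {W : ℝ → Weights m d} {V : Weights m d} {t : ℝ}
    (h : HasDerivAt W V t) (r : Fin m) (z : EuclideanSpace ℝ (Fin d)) :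
    HasDerivAt (fun s => inner ℝ (W s r) z) (inner ℝ (V r) z) t := by
  have h1 := hasDerivAt_pi.1 h r
  simpa using h1.inner ℝ (hasDerivAt_const t z)

theorem locAC_weight {W : ℝ → Weights m d} (hW : LocAC W) (r : Fin m) :
    LocAC (fun t => W t r) := fun T hT =>
  absolutelyContinuousOnInterval_lipschitz_comp (L := fun v : Weights m d => v r)
    (LipschitzWith.eval (α := fun _ : Fin m => EuclideanSpace ℝ (Fin d)) r) (hW T hT)

theorem locAC_relu {W : ℝ → Weights m d} (hW : LocAC W) (r : Fin m)
    (z : EuclideanSpace ℝ (Fin d)) : LocAC fun t => max 0 (inner ℝ (W t r) z) := by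
  intro T hT
  have h := absolutelyContinuousOnInterval_lipschitz_comp
    ((innerSL ℝ z).lipschitz.const_max 0) (locAC_weight hW r T hT)
  simpa only [innerSL_apply_apply, real_inner_comm] using h

theorem locAC_network {W : ℝ → Weights m d} (hW : LocAC W) (a : Fin m → ℝ)
    (z : EuclideanSpace ℝ (Fin d)) : LocAC fun t => network a (W t) z := fun T hT =>
  (absolutelyContinuousOnInterval_sum _ fun r _ =>
    (locAC_relu hW r z T hT).const_mul (a r)).const_mul _

/-- The exceptional null set is fixed before V and the selection h. The formula can thus be used
with the very selection that occurs in the flow at the training points, and with `step` at any other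
point. -/
theorem ae_hasDerivAt_network {W : ℝ → Weights m d} (hW : LocAC W) (a : Fin m → ℝ)
    (z : EuclideanSpace ℝ (Fin d)) :
    ∀ᵐ t ∂(volume.restrict (Set.Ioi (0 : ℝ))), ∀ V : Weights m d, HasDerivAt W V t →
      ∀ h : Fin m → ℝ, (∀ r, h r ∈ reluDeriv (inner ℝ (W t r) z)) →
        HasDerivAt (fun s => network a (W s) z)
          ((1 / Real.sqrt m) * ∑ r, a r * (h r * inner ℝ (V r) z)) t := by
  have h1 : ∀ r, ∀ᵐ t ∂(volume.restrict (Set.Ioi (0 : ℝ))),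
      DifferentiableAt ℝ (fun t => max 0 (inner ℝ (W t r) z)) t :=
    fun r => (locAC_relu hW r z).ae_differentiableAt
  filter_upwards [ae_all_iff.2 h1] with t ht V hV h hh
  refine (HasDerivAt.fun_sum fun r _ => ?_).const_mul _
  exact (hasDerivAt_relu (hasDerivAt_inner_weight hV r z) (ht r) (hh r)).const_mul _

variable {ι : Type} [Fintype ι] {x : ι → EuclideanSpace ℝ (Fin d)} {y : ι → ℝ} {lam : ℝ}
  {a : Fin m → ℝ} {W₀ : Weights m d} {W : ℝ → Weights m d}

/-- The derivative of the left side is −2∑‖V r‖²: the selection g defining the velocity also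
computes the derivatives of the training predictions, kinks included. -/
theorem IsGradientFlow.loss_le (h : IsGradientFlow x y lam a W₀ W) {t : ℝ} (ht : 0 ≤ t) :
    ∑ j, (y j - network a (W t) (x j)) ^ 2 + lam * ∑ r, ‖W t r - W₀ r‖ ^ 2
      ≤ ∑ j, (y j - network a W₀ (x j)) ^ 2 := by
  have hW : LocAC W := h.absCont
  set s : ℝ := 1 / Real.sqrt m with hs
  have hD : ∀ r, LocAC fun t => ‖W t r - W₀ r‖ := fun r T hT =>
    absolutelyContinuousOnInterval_lipschitz_comp lipschitzWith_one_norm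
      ((locAC_weight hW r T hT).fun_sub (absolutelyContinuousOnInterval_const _ _ _))
  have hres : ∀ j, LocAC fun t => y j - network a (W t) (x j) := fun j T hT =>
    (absolutelyContinuousOnInterval_const _ _ _).fun_sub (locAC_network hW a (x j) T hT)
  have hL : LocAC fun t => ∑ j, (y j - network a (W t) (x j)) ^ 2
      + lam * ∑ r, ‖W t r - W₀ r‖ ^ 2 := by
    intro T hT
    simp only [sq]
    exact (absolutelyContinuousOnInterval_sum _ fun j _ =>
      (hres j T hT).fun_mul (hres j T hT)).fun_add
      ((absolutelyContinuousOnInterval_sum _ fun r _ =>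
        (hD r T hT).fun_mul (hD r T hT)).const_mul _)
  have := hL.le_zero (by
    filter_upwards [h.flow, ae_all_iff.2 fun j => ae_hasDerivAt_network hW a (x j)]
      with t ⟨V, ⟨g, hg, hVg⟩, hV⟩ hN
    have hu := fun j => hN j V hV (g j) (hg j)
    have hd1 : ∀ j, HasDerivAt (fun t => (y j - network a (W t) (x j)) ^ 2)
        (-(2 * (y j - network a (W t) (x j)) *
          (s * ∑ r, a r * (g j r * inner ℝ (V r) (x j))))) t := by
      intro j
      refine (((hu j).const_sub (y j)).pow 2).congr_deriv ?_
      simp only [hs]; push_cast; ring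
    have hd2 : ∀ r, HasDerivAt (fun t => ‖W t r - W₀ r‖ ^ 2)
        (2 * inner ℝ (W t r - W₀ r) (V r)) t := fun r =>
      ((hasDerivAt_pi.1 hV r).sub_const (W₀ r)).norm_sq
    refine ⟨_, ?_, (HasDerivAt.fun_sum fun j _ => hd1 j).fun_add
      ((HasDerivAt.fun_sum fun r _ => hd2 r).const_mul lam)⟩
    -- Pair the flow equation for V with V itself.
    have key : ∑ r, ‖V r‖ ^ 2 = ∑ j, (y j - network a (W t) (x j)) *
        (s * ∑ r, a r * (g j r * inner ℝ (V r) (x j)))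
        - lam * ∑ r, inner ℝ (W t r - W₀ r) (V r) := by
      have : ∀ r, ‖V r‖ ^ 2 = ∑ j, (y j - network a (W t) (x j)) * (s * a r * g j r)
          * inner ℝ (V r) (x j) - lam * inner ℝ (W t r - W₀ r) (V r) := by
        intro r
        rw [← real_inner_self_eq_norm_sq]
        nth_rewrite 1 [hVg r]
        rw [inner_sub_left, sum_inner, inner_smul_left]
        simp only [inner_smul_left, conj_trivial]
        congr 1
        exact Finset.sum_congr rfl fun j _ => by rw [real_inner_comm]
      simp only [this, Finset.sum_sub_distrib, ← Finset.mul_sum]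
      congr 1
      rw [Finset.sum_comm]
      refine Finset.sum_congr rfl fun j _ => ?_
      rw [Finset.mul_sum, Finset.mul_sum]
      exact Finset.sum_congr rfl fun r _ => by ring
    have h0 : 0 ≤ ∑ r, ‖V r‖ ^ 2 := Finset.sum_nonneg fun _ _ => by positivity
    have e1 : ∑ j, -(2 * (y j - network a (W t) (x j)) *
          (s * ∑ r, a r * (g j r * inner ℝ (V r) (x j))))
        = - (2 * ∑ j, (y j - network a (W t) (x j)) *
          (s * ∑ r, a r * (g j r * inner ℝ (V r) (x j)))) := by
      rw [Finset.mul_sum, ← Finset.sum_neg_distrib]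
      exact Finset.sum_congr rfl fun j _ => by ring
    rw [e1, ← Finset.mul_sum]
    linarith) ht
  simpa [h.init] using this

/-- Cauchy–Schwarz with N only an upper bound for the number of points, so that the full and the
leave-one-out data share all constants. -/
theorem sum_abs_le_of_sum_sq_le {v : ι → ℝ} {S N : ℝ} (hS : 0 ≤ S)
    (hN : (Fintype.card ι : ℝ) ≤ N) (hv : ∑ j, v j ^ 2 ≤ S ^ 2) :
    ∑ j, |v j| ≤ Real.sqrt N * S := by
  have h1 : (∑ j, |v j|) ^ 2 ≤ (Real.sqrt N * S) ^ 2 := by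
    have := sq_sum_le_card_mul_sum_sq (s := (Finset.univ : Finset ι)) (f := fun j => |v j|)
    simp only [sq_abs, Finset.card_univ] at this
    have hN0 : 0 ≤ N := le_trans (by positivity) hN
    rw [mul_pow, Real.sq_sqrt hN0]
    exact this.trans (mul_le_mul hN hv (Finset.sum_nonneg fun _ _ => sq_nonneg _) hN0)
  exact abs_le_of_sq_le_sq' h1 (by positivity) |>.2

theorem IsGradientFlow.residual_le (h : IsGradientFlow x y lam a W₀ W) (hlam : 0 < lam) {S : ℝ}
    (hS : ∑ j, (y j - network a W₀ (x j)) ^ 2 ≤ S ^ 2) {t : ℝ} (ht : 0 ≤ t) :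
    ∑ j, (y j - network a (W t) (x j)) ^ 2 ≤ S ^ 2 := by
  have h1 := h.loss_le ht
  have h2 : 0 ≤ lam * ∑ r, ‖W t r - W₀ r‖ ^ 2 :=
    mul_nonneg hlam.le (Finset.sum_nonneg fun _ _ => by positivity)
  linarith

theorem IsGradientFlow.abs_network_sub_le (h : IsGradientFlow x y lam a W₀ W)
    (ha : ∀ r, |a r| = 1) (hlam : 0 < lam) {S : ℝ} (hS0 : 0 ≤ S)
    (hS : ∑ j, (y j - network a W₀ (x j)) ^ 2 ≤ S ^ 2) {t : ℝ} (ht : 0 ≤ t)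
    {z : EuclideanSpace ℝ (Fin d)} (hz : ‖z‖ = 1) :
    |network a (W t) z - network a W₀ z| ≤ S / Real.sqrt lam := by
  refine (WideReLU.abs_network_sub_le ha _ _ z hz).trans ?_
  rw [Real.sqrt_le_left (by positivity), div_pow, Real.sq_sqrt hlam.le, le_div_iff₀ hlam]
  have h1 := h.loss_le ht
  have h2 : 0 ≤ ∑ j, (y j - network a (W t) (x j)) ^ 2 :=
    Finset.sum_nonneg fun _ _ => by positivity
  linarith

/-- No weight moves by more than `√N S / (λ √m)`. -/
theorem IsGradientFlow.norm_weight_sub_le (h : IsGradientFlow x y lam a W₀ W)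
    (ha : ∀ r, |a r| = 1) (hx : ∀ j, ‖x j‖ = 1) (hlam : 0 < lam) {S N : ℝ} (hS0 : 0 ≤ S)
    (hN : (Fintype.card ι : ℝ) ≤ N)
    (hS : ∑ j, (y j - network a W₀ (x j)) ^ 2 ≤ S ^ 2) {t : ℝ} (ht : 0 ≤ t) (r : Fin m) :
    ‖W t r - W₀ r‖ ≤ (1 / Real.sqrt m) * (Real.sqrt N * S) / lam := by
  have hW : LocAC W := h.absCont
  set B : ℝ := (1 / Real.sqrt m) * (Real.sqrt N * S) with hB
  have hB0 : 0 ≤ B := by positivity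
  have hD : LocAC fun t => ‖W t r - W₀ r‖ := fun T hT =>
    absolutelyContinuousOnInterval_lipschitz_comp lipschitzWith_one_norm
      ((locAC_weight hW r T hT).fun_sub (absolutelyContinuousOnInterval_const _ _ _))
  have hq : LocAC fun t => ‖W t r - W₀ r‖ ^ 2 := by
    intro T hT
    simp only [sq]
    exact (hD T hT).fun_mul (hD T hT)
  -- The squared norm is used because it is differentiable at 0. With D = ‖W t r − W₀ r‖, its
  -- derivative is at most 2DB − 2λD² ≤ λ((B/λ)² − D²).
  have := hq.le_of_deriv_le (lam := lam) (c := (B / lam) ^ 2)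
    (by simp only [h.init, sub_self, norm_zero, zero_pow two_ne_zero]; positivity) (by
    filter_upwards [h.flow, ae_restrict_mem measurableSet_Ioi] with t ⟨V, ⟨g, hg, hVg⟩, hV⟩ ht
    refine ⟨_, ?_, ((hasDerivAt_pi.1 hV r).sub_const (W₀ r)).norm_sq⟩
    set v := ∑ j, ((y j - network a (W t) (x j)) * ((1 / Real.sqrt m) * a r * g j r)) • x j
      with hv
    have hvB : ‖v‖ ≤ B := by
      refine (norm_sum_le _ _).trans ?_
      have h1 : ∀ j, ‖((y j - network a (W t) (x j)) * ((1 / Real.sqrt m) * a r * g j r)) • x j‖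
          ≤ (1 / Real.sqrt m) * |y j - network a (W t) (x j)| := by
        intro j
        rw [norm_smul, hx j, mul_one, Real.norm_eq_abs, abs_mul, abs_mul, abs_mul, ha r,
          abs_of_nonneg (show 0 ≤ 1 / Real.sqrt m by positivity), abs_of_nonneg (hg j r).1,
          mul_one, mul_comm]
        refine mul_le_mul_of_nonneg_right ?_ (abs_nonneg _)
        exact mul_le_of_le_one_right (by positivity) (hg j r).2.1
      refine (Finset.sum_le_sum fun j _ => h1 j).trans ?_
      rw [← Finset.mul_sum]
      exact mul_le_mul_of_nonneg_left (sum_abs_le_of_sum_sq_le hS0 hN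
        (h.residual_le hlam hS (le_of_lt ht))) (by positivity)
    rw [hVg r, ← hv, inner_sub_right, inner_smul_right, real_inner_self_eq_norm_sq]
    have h2 : inner ℝ (W t r - W₀ r) v ≤ ‖W t r - W₀ r‖ * B :=
      (real_inner_le_norm _ _).trans (mul_le_mul_of_nonneg_left hvB (norm_nonneg _))
    have h3 : 0 ≤ lam * (B / lam - ‖W t r - W₀ r‖) ^ 2 := by positivity
    have h4 : B = lam * (B / lam) := by field_simp
    rw [h4] at h2
    linarith [h2, h3, show lam * (B / lam - ‖W t r - W₀ r‖) ^ 2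
      = lam * ((B / lam) ^ 2 - ‖W t r - W₀ r‖ ^ 2)
        - 2 * (‖W t r - W₀ r‖ * (lam * (B / lam)) - lam * ‖W t r - W₀ r‖ ^ 2) by ring]) ht
  exact abs_le_of_sq_le_sq' this (by positivity) |>.2

/-- The deviation of the velocity of the prediction at `z` from the one of kernel regression
with kernel `K`. -/
noncomputable def driftBound (K : EuclideanSpace ℝ (Fin d) → EuclideanSpace ℝ (Fin d) → ℝ)
    (x : ι → EuclideanSpace ℝ (Fin d)) (lam : ℝ) (W₀ : Weights m d) (R S N : ℝ)
    (z : EuclideanSpace ℝ (Fin d)) : ℝ :=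
  S * (Real.sqrt N * flipFraction W₀ R z + ∑ k, flipFraction W₀ R (x k)
    + Real.sqrt (∑ k, (empKernel W₀ z (x k) - K z (x k)) ^ 2))
    + lam * (Real.sqrt m * flipFraction W₀ R z * R)

theorem sum_mul_le_of_sum_sq_le {v w : ι → ℝ} {S : ℝ} (hS : 0 ≤ S)
    (hv : ∑ j, v j ^ 2 ≤ S ^ 2) : ∑ j, |v j| * |w j| ≤ S * Real.sqrt (∑ j, w j ^ 2) := by
  have := Real.sum_mul_le_sqrt_mul_sqrt Finset.univ (fun j => |v j|) (fun j => |w j|)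
  simp only [sq_abs] at this
  refine this.trans (mul_le_mul_of_nonneg_right ?_ (Real.sqrt_nonneg _))
  rwa [Real.sqrt_le_left hS]

theorem abs_le_of_sum_sq_le {v : ι → ℝ} {S : ℝ} (hS : 0 ≤ S)
    (hv : ∑ j, v j ^ 2 ≤ S ^ 2) (j : ι) : |v j| ≤ S := by
  refine abs_le_of_sq_le_sq ?_ hS
  exact (Finset.single_le_sum (f := fun j => v j ^ 2) (fun _ _ => sq_nonneg _)
    (Finset.mem_univ j)).trans hv

/-- The velocity of the prediction at `z` is that of kernel regression up to `driftBound`. -/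
theorem abs_velocity_sub_le
    (K : EuclideanSpace ℝ (Fin d) → EuclideanSpace ℝ (Fin d) → ℝ) (hm : 0 < m)
    (ha : ∀ r, |a r| = 1) (hx : ∀ j, ‖x j‖ = 1) (hlam : 0 < lam) {S N R : ℝ} (hS0 : 0 ≤ S)
    (hN : (Fintype.card ι : ℝ) ≤ N) {z : EuclideanSpace ℝ (Fin d)} (hz : ‖z‖ = 1)
    {U V : Weights m d} {g : ι → Fin m → ℝ} (hR : ∀ r, ‖U r - W₀ r‖ ≤ R)
    (hS : ∑ j, (y j - network a U (x j)) ^ 2 ≤ S ^ 2)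
    (hg : ∀ j r, g j r ∈ reluDeriv (inner ℝ (U r) (x j)))
    (hVg : ∀ r, V r = (∑ j, ((y j - network a U (x j)) * ((1 / Real.sqrt m) * a r * g j r)) • x j)
      - lam • (U r - W₀ r)) :
    |(1 / Real.sqrt m) * ∑ r, a r * (step (inner ℝ (U r) z) * inner ℝ (V r) z)
      - (∑ k, K z (x k) * (y k - network a U (x k)) - lam * (network a U z - network a W₀ z))|
      ≤ driftBound K x lam W₀ R S N z := by
  have hm' : (0 : ℝ) < m := by exact_mod_cast hm
  set s : ℝ := 1 / Real.sqrt m with hs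
  have hs0 : 0 ≤ s := by positivity
  have hss : s * s = 1 / m := by
    rw [hs, div_mul_div_comm, Real.mul_self_sqrt hm'.le, one_mul]
  have hsm : s * m = Real.sqrt m := by
    rw [hs]
    have := Real.mul_self_sqrt hm'.le
    have h0 : 0 < Real.sqrt m := Real.sqrt_pos.2 hm'
    field_simp
    linarith
  have haa : ∀ r, a r * a r = 1 := fun r => by rw [← abs_mul_abs_self, ha r, one_mul]
  set res : ι → ℝ := fun k => y k - network a U (x k) with hres
  set h : Fin m → ℝ := fun r => step (inner ℝ (U r) z) with hh
  have hclose : ∀ r (v : EuclideanSpace ℝ (Fin d)), ‖v‖ = 1 →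
      |inner ℝ (U r) v - inner ℝ (W₀ r) v| ≤ R := by
    intro r v hv
    rw [← inner_sub_left]
    refine (abs_real_inner_le_norm _ _).trans ?_
    rw [hv, mul_one]
    exact hR r
  have hnet : network a U z = s * ∑ r, a r * (h r * inner ℝ (U r) z) := by
    simp only [network, hh, mul_eq_relu (step_mem _), hs]
  have e1 : s * ∑ r, a r * (h r * inner ℝ (V r) z)
      = ∑ k, res k * ((1 / m) * ∑ r, h r * g k r * inner ℝ z (x k))
        - lam * (network a U z - s * ∑ r, a r * (h r * inner ℝ (W₀ r) z)) := by
    have hV : ∀ r, a r * (h r * inner ℝ (V r) z)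
        = ∑ k, res k * (s * (h r * g k r * inner ℝ z (x k)))
          - lam * (a r * (h r * inner ℝ (U r) z) - a r * (h r * inner ℝ (W₀ r) z)) := by
      intro r
      rw [hVg r, inner_sub_left, sum_inner, inner_smul_left, inner_sub_left]
      simp only [inner_smul_left, conj_trivial, mul_sub, Finset.mul_sum]
      congr 1
      · refine Finset.sum_congr rfl fun k _ => ?_
        rw [real_inner_comm z (x k)]
        linear_combination (h r * (res k * (s * g k r)) * inner ℝ z (x k)) * haa r
      · ring
    simp only [hV, Finset.sum_sub_distrib, ← Finset.mul_sum, mul_sub]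
    rw [hnet, Finset.sum_comm, Finset.mul_sum]
    congr 1
    · refine Finset.sum_congr rfl fun k _ => ?_
      simp only [← Finset.mul_sum]
      linear_combination (res k * ∑ r, h r * g k r * inner ℝ z (x k)) * hss
    · ring
  -- Three sources of drift: the tangent kernel moves during training, the initial kernel differs
  -- from K, and the current gates applied to the initial weights do not reproduce the initial
  -- output exactly.
  have e2 : s * ∑ r, a r * (h r * inner ℝ (V r) z)
      - (∑ k, K z (x k) * res k - lam * (network a U z - network a W₀ z))
      = ∑ k, res k * ((1 / m) * ∑ r, h r * g k r * inner ℝ z (x k) - empKernel W₀ z (x k))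
        + ∑ k, res k * (empKernel W₀ z (x k) - K z (x k))
        + lam * (s * ∑ r, a r * (h r * inner ℝ (W₀ r) z - max 0 (inner ℝ (W₀ r) z))) := by
    rw [e1]
    have e3 : network a W₀ z = s * ∑ r, a r * max 0 (inner ℝ (W₀ r) z) := rfl
    rw [e3]
    simp only [mul_sub, Finset.sum_sub_distrib]
    have : ∑ k, K z (x k) * res k = ∑ k, res k * K z (x k) :=
      Finset.sum_congr rfl fun k _ => mul_comm _ _
    rw [this]
    ring
  rw [e2]
  have b1 : ∀ k, |(1 / m : ℝ) * ∑ r, h r * g k r * inner ℝ z (x k) - empKernel W₀ z (x k)|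
      ≤ flipFraction W₀ R z + flipFraction W₀ R (x k) := by
    intro k
    unfold empKernel flipFraction
    rw [← mul_sub, ← mul_add, ← Finset.sum_sub_distrib, ← Finset.sum_add_distrib, abs_mul,
      abs_of_nonneg (show (0 : ℝ) ≤ 1 / m by positivity)]
    refine mul_le_mul_of_nonneg_left ((Finset.abs_sum_le_sum_abs _ _).trans ?_) (by positivity)
    refine Finset.sum_le_sum fun r _ => ?_
    rw [← sub_mul, abs_mul]
    have hin : |inner ℝ z (x k)| ≤ 1 := by
      simpa [hz, hx k] using abs_real_inner_le_norm z (x k)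
    have f1 := abs_sub_step_le (step_mem (inner ℝ (U r) z)) (hclose r z hz)
    have f2 := abs_sub_step_le (hg k r) (hclose r (x k) (hx k))
    have g0 := (hg k r).1
    have g1 := (hg k r).2.1
    have s0 := (step_mem (inner ℝ (W₀ r) z)).1
    have s1 := (step_mem (inner ℝ (W₀ r) z)).2.1
    refine (mul_le_of_le_one_right (abs_nonneg _) hin).trans ?_
    have e : h r * g k r - step (inner ℝ (W₀ r) z) * step (inner ℝ (W₀ r) (x k))
        = (h r - step (inner ℝ (W₀ r) z)) * g k r
          + step (inner ℝ (W₀ r) z) * (g k r - step (inner ℝ (W₀ r) (x k))) := by ring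
    rw [e]
    refine (abs_add_le _ _).trans (add_le_add ?_ ?_)
    · rw [abs_mul, abs_of_nonneg g0]
      exact (mul_le_of_le_one_right (abs_nonneg _) g1).trans f1
    · rw [abs_mul, abs_of_nonneg s0]
      exact (mul_le_of_le_one_left (abs_nonneg _) s1).trans f2
  -- Flips at z are common to all k and meet the ℓ¹ norm of the residual, at most √N S; flips at x k
  -- are summed over k and need only the maximal residual, at most S.
  have B1 : |∑ k, res k * ((1 / m) * ∑ r, h r * g k r * inner ℝ z (x k) - empKernel W₀ z (x k))|
      ≤ S * (Real.sqrt N * flipFraction W₀ R z + ∑ k, flipFraction W₀ R (x k)) := by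
    refine (Finset.abs_sum_le_sum_abs _ _).trans ?_
    have : ∀ k, |res k * ((1 / m) * ∑ r, h r * g k r * inner ℝ z (x k) - empKernel W₀ z (x k))|
        ≤ |res k| * flipFraction W₀ R z + S * flipFraction W₀ R (x k) := by
      intro k
      rw [abs_mul]
      refine (mul_le_mul_of_nonneg_left (b1 k) (abs_nonneg _)).trans ?_
      rw [mul_add]
      gcongr
      · exact flipFraction_nonneg _ _ _
      · exact abs_le_of_sum_sq_le hS0 hS k
    refine (Finset.sum_le_sum fun k _ => this k).trans ?_
    rw [Finset.sum_add_distrib, ← Finset.sum_mul, ← Finset.mul_sum, mul_add]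
    have h5 := mul_le_mul_of_nonneg_right (sum_abs_le_of_sum_sq_le hS0 hN hS)
      (flipFraction_nonneg W₀ R z)
    linarith
  have B2 : |∑ k, res k * (empKernel W₀ z (x k) - K z (x k))|
      ≤ S * Real.sqrt (∑ k, (empKernel W₀ z (x k) - K z (x k)) ^ 2) := by
    refine (Finset.abs_sum_le_sum_abs _ _).trans ?_
    simp only [abs_mul]
    exact sum_mul_le_of_sum_sq_le hS0 hS
  have B3 : |s * ∑ r, a r * (h r * inner ℝ (W₀ r) z - max 0 (inner ℝ (W₀ r) z))|
      ≤ Real.sqrt m * flipFraction W₀ R z * R := by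
    rw [abs_mul, abs_of_nonneg hs0]
    have : |∑ r, a r * (h r * inner ℝ (W₀ r) z - max 0 (inner ℝ (W₀ r) z))|
        ≤ ∑ r, flip R (inner ℝ (W₀ r) z) * R := by
      refine (Finset.abs_sum_le_sum_abs _ _).trans (Finset.sum_le_sum fun r _ => ?_)
      rw [abs_mul, ha r, one_mul]
      exact abs_mul_sub_relu_le (step_mem _) (hclose r z hz)
    refine (mul_le_mul_of_nonneg_left this hs0).trans (le_of_eq ?_)
    unfold flipFraction
    rw [← Finset.sum_mul, ← hsm]
    field_simp
  refine (abs_add_le _ _).trans ?_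
  rw [abs_mul, abs_of_pos hlam]
  have h6 := abs_add_le
    (∑ k, res k * ((1 / m) * ∑ r, h r * g k r * inner ℝ z (x k) - empKernel W₀ z (x k)))
    (∑ k, res k * (empKernel W₀ z (x k) - K z (x k)))
  have h7 := mul_le_mul_of_nonneg_left B3 hlam.le
  unfold driftBound
  rw [mul_add S]
  linarith

/-- The limit of the predictions satisfies the normal equations of kernel ridge regression up to
`driftBound`. -/
theorem IsGradientFlow.abs_limit_le (h : IsGradientFlow x y lam a W₀ W)
    (K : EuclideanSpace ℝ (Fin d) → EuclideanSpace ℝ (Fin d) → ℝ) (hm : 0 < m)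
    (ha : ∀ r, |a r| = 1) (hx : ∀ j, ‖x j‖ = 1) (hlam : 0 < lam) {S N R : ℝ} (hS0 : 0 ≤ S)
    (hN : (Fintype.card ι : ℝ) ≤ N)
    (hS : ∑ j, (y j - network a W₀ (x j)) ^ 2 ≤ S ^ 2)
    (hR : (1 / Real.sqrt m) * (Real.sqrt N * S) / lam ≤ R)
    {f : EuclideanSpace ℝ (Fin d) → ℝ}
    (hf : ∀ z, Tendsto (fun t => network a (W t) z) atTop (𝓝 (f z)))
    {z : EuclideanSpace ℝ (Fin d)} (hz : ‖z‖ = 1) :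
    |∑ k, K z (x k) * (y k - f (x k)) - lam * (f z - network a W₀ z)|
      ≤ driftBound K x lam W₀ R S N z := by
  have hW : LocAC W := h.absCont
  refine (locAC_network hW a z).abs_limit_le (hf z)
    (A := fun t => ∑ k, K z (x k) * (y k - network a (W t) (x k))
      - lam * (network a (W t) z - network a W₀ z)) ?_ ?_
  · exact (tendsto_finsetSum _ fun k _ => ((hf (x k)).const_sub _).const_mul _).sub
      (((hf z).sub_const _).const_mul _)
  · filter_upwards [h.flow, ae_restrict_mem measurableSet_Ioi, ae_hasDerivAt_network hW a z]
      with t ⟨V, ⟨g, hg, hVg⟩, hV⟩ ht hN'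
    refine ⟨_, ?_, hN' V hV _ fun r => step_mem _⟩
    exact abs_velocity_sub_le K hm ha hx hlam hS0 hN hz
      (fun r => (h.norm_weight_sub_le ha hx hlam hS0 hN hS (le_of_lt ht) r).trans hR)
      (h.residual_le hlam hS (le_of_lt ht)) hg hVg

end Flow

end WideReLU

namespace WideReLU

/-! ### The NTK and the ridge regression weights. -/

section Kernel

variable {d : ℕ}

theorem measurable_step : Measurable step :=
  Measurable.ite measurableSet_Ici measurable_const measurable_const

theorem step_nonneg (z : ℝ) : 0 ≤ step z := (step_mem z).1

theorem step_le_one (z : ℝ) : step z ≤ 1 := (step_mem z).2.1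

theorem measurable_step_inner (z : EuclideanSpace ℝ (Fin d)) :
    Measurable fun w : EuclideanSpace ℝ (Fin d) => step (inner ℝ w z) :=
  measurable_step.comp (by fun_prop)

theorem ntk_eq_integral (x x' : EuclideanSpace ℝ (Fin d)) :
    ntk x x' = ∫ w, step (inner ℝ w x) * step (inner ℝ w x') * inner ℝ x x'
      ∂(stdGaussian (EuclideanSpace ℝ (Fin d))) := by
  unfold ntk
  congr 1
  ext w
  unfold step Set.indicator
  by_cases h1 : 0 ≤ inner ℝ w x <;> by_cases h2 : 0 ≤ inner ℝ w x' <;> simp [h1, h2]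

theorem integrable_ntk_integrand (x x' : EuclideanSpace ℝ (Fin d)) :
    Integrable (fun w => step (inner ℝ w x) * step (inner ℝ w x') * inner ℝ x x')
      (stdGaussian (EuclideanSpace ℝ (Fin d))) := by
  refine Integrable.of_bound (C := |inner ℝ x x'|)
    (((measurable_step_inner x).mul (measurable_step_inner x')).mul_const _).aestronglyMeasurable
    (Eventually.of_forall fun w => ?_)
  rw [Real.norm_eq_abs, abs_mul, abs_of_nonneg (mul_nonneg (step_nonneg _) (step_nonneg _))]
  exact mul_le_of_le_one_left (abs_nonneg _)
    (mul_le_one₀ (step_le_one _) (step_nonneg _) (step_le_one _))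

theorem ntk_comm (x x' : EuclideanSpace ℝ (Fin d)) : ntk x x' = ntk x' x := by
  simp only [ntk_eq_integral, real_inner_comm x' x]
  congr 1
  ext w
  ring

theorem ntk_self_le_one {z : EuclideanSpace ℝ (Fin d)} (hz : ‖z‖ = 1) : ntk z z ≤ 1 := by
  rw [ntk_eq_integral]
  have h : ∫ w, step (inner ℝ w z) * step (inner ℝ w z) * inner ℝ z z
      ∂(stdGaussian (EuclideanSpace ℝ (Fin d)))
      ≤ ∫ _, (1 : ℝ) ∂(stdGaussian (EuclideanSpace ℝ (Fin d))) := by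
    refine integral_mono (integrable_ntk_integrand z z) (integrable_const _) fun w => ?_
    simp only [real_inner_self_eq_norm_sq, hz, one_pow, mul_one]
    exact mul_le_one₀ (step_le_one _) (step_nonneg _) (step_le_one _)
  simpa using h

/-- The quadratic form is the expectation of ‖∑ c_i 1{⟨w, z_i⟩ ≥ 0} z_i‖². -/
theorem ntk_posSemidef {J : Type*} [Fintype J] (z : J → EuclideanSpace ℝ (Fin d)) (c : J → ℝ) :
    0 ≤ ∑ i, ∑ j, c i * c j * ntk (z i) (z j) := by
  have h : ∑ i, ∑ j, c i * c j * ntk (z i) (z j)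
      = ∫ w, ‖∑ i, (c i * step (inner ℝ w (z i))) • z i‖ ^ 2
        ∂(stdGaussian (EuclideanSpace ℝ (Fin d))) := by
    simp only [ntk_eq_integral, ← integral_const_mul]
    have hint := fun i j => (integrable_ntk_integrand (z i) (z j)).const_mul (c i * c j)
    simp only [← integral_finsetSum _ fun j _ => hint _ j]
    rw [← integral_finsetSum _ fun i _ => integrable_finsetSum _ fun j _ => hint i j]
    congr 1
    ext w
    rw [← real_inner_self_eq_norm_sq, sum_inner]
    simp only [inner_sum, inner_smul_left, inner_smul_right, conj_trivial]
    exact Finset.sum_congr rfl fun i _ => Finset.sum_congr rfl fun j _ => by ring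
  rw [h]
  exact integral_nonneg fun w => by positivity

open Matrix in
theorem isUnit_det_regularized {ι : Type} [Fintype ι] [DecidableEq ι]
    (x : ι → EuclideanSpace ℝ (Fin d)) {lam : ℝ} (hlam : 0 < lam) :
    IsUnit ((Matrix.of fun i j => ntk (x i) (x j)) + lam • (1 : Matrix ι ι ℝ)).det := by
  have h1 : (Matrix.of fun i j => ntk (x i) (x j)).PosSemidef := by
    refine Matrix.PosSemidef.of_dotProduct_mulVec_nonneg ?_ fun c => ?_
    · ext i j
      simp [ntk_comm (x i) (x j)]
    · have := ntk_posSemidef x c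
      simp only [dotProduct, mulVec, star_trivial, Finset.mul_sum, Matrix.of_apply]
      refine this.trans (le_of_eq ?_)
      exact Finset.sum_congr rfl fun i _ => Finset.sum_congr rfl fun j _ => by ring
  have h2 : (lam • (1 : Matrix ι ι ℝ)).PosDef := Matrix.PosDef.one.smul hlam
  exact (Matrix.isUnit_iff_isUnit_det _).1 (h2.posSemidef_add h1).isUnit

/-- The weights with which ridge regression combines the labels: they solve
`(K_tr + λ) q = K_z` and have norm at most `λ^{-1/2}`. -/
theorem exists_ridge_weights {ι : Type} [Fintype ι] [DecidableEq ι]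
    (x : ι → EuclideanSpace ℝ (Fin d)) {lam : ℝ} (hlam : 0 < lam)
    {z : EuclideanSpace ℝ (Fin d)} (hz : ‖z‖ = 1) :
    ∃ q : ι → ℝ, (∀ i, ∑ j, ntk (x i) (x j) * q j + lam * q i = ntk z (x i)) ∧
      (∀ y : ι → ℝ, ntkPredictor x y lam z = ∑ j, q j * y j) ∧
      ∑ j, q j ^ 2 ≤ (1 / Real.sqrt lam) ^ 2 := by
  set M : Matrix ι ι ℝ := (Matrix.of fun i j => ntk (x i) (x j)) + lam • (1 : Matrix ι ι ℝ)
    with hM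
  have hdet : IsUnit M.det := isUnit_det_regularized x hlam
  have hsymm : M.transpose = M := by
    ext i j
    by_cases hij : i = j
    · simp [hij]
    · simp [hM, ntk_comm (x j) (x i), Matrix.one_apply_ne hij, Matrix.one_apply_ne (Ne.symm hij)]
  set k : ι → ℝ := fun i => ntk z (x i) with hk
  set q : ι → ℝ := Matrix.mulVec M⁻¹ k with hq
  have hMq : Matrix.mulVec M q = k := by
    rw [hq, Matrix.mulVec_mulVec, Matrix.mul_nonsing_inv _ hdet, Matrix.one_mulVec]
  have heq : ∀ i, ∑ j, ntk (x i) (x j) * q j + lam * q i = ntk z (x i) := by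
    intro i
    have := congrFun hMq i
    rw [hM, Matrix.add_mulVec, Matrix.smul_mulVec, Matrix.one_mulVec] at this
    simpa [Matrix.mulVec, dotProduct] using this
  refine ⟨q, heq, fun y => ?_, ?_⟩
  · have h1 : ntkPredictor x y lam z = dotProduct k (Matrix.mulVec M⁻¹ y) := rfl
    have h2 : Matrix.vecMul k M⁻¹ = q := by
      rw [← Matrix.mulVec_transpose, Matrix.transpose_nonsing_inv, hsymm]
    rw [h1, Matrix.dotProduct_mulVec, h2]
    rfl
  -- Positivity on z together with the training points, tested on (1, −q), gives K(z,z) − 2q·K_z +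
  -- q·K_tr q ≥ 0. Since q·K_z = q·K_tr q + λ‖q‖² and K(z,z) ≤ 1, this bounds λ‖q‖² by 1.
  · have hp := ntk_posSemidef (fun o : Option ι => o.elim z x)
      (fun o : Option ι => o.elim 1 fun i => -q i)
    simp only [Fintype.sum_option, Option.elim] at hp
    have hzz := ntk_self_le_one hz
    have e1 : ∑ i, q i * ntk z (x i) = ∑ i, ∑ j, q i * q j * ntk (x i) (x j)
        + lam * ∑ i, q i ^ 2 := by
      rw [Finset.mul_sum, ← Finset.sum_add_distrib]
      refine Finset.sum_congr rfl fun i _ => ?_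
      rw [← heq i, mul_add, Finset.mul_sum]
      congr 1
      · exact Finset.sum_congr rfl fun j _ => by ring
      · ring
    have e2 : ∑ i, 1 * -q i * ntk z (x i) = -∑ i, q i * ntk z (x i) := by
      rw [← Finset.sum_neg_distrib]
      exact Finset.sum_congr rfl fun j _ => by ring
    have e3 : ∑ i, (-q i * 1 * ntk (x i) z + ∑ j, -q i * -q j * ntk (x i) (x j))
        = -∑ i, q i * ntk z (x i) + ∑ i, ∑ j, q i * q j * ntk (x i) (x j) := by
      rw [← Finset.sum_neg_distrib, ← Finset.sum_add_distrib]
      refine Finset.sum_congr rfl fun i _ => ?_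
      rw [ntk_comm (x i) z]
      congr 1
      · ring
      · exact Finset.sum_congr rfl fun j _ => by ring
    rw [e2, e3] at hp
    have hpos := ntk_posSemidef x q
    have h0 : 0 ≤ ∑ i, q i ^ 2 := Finset.sum_nonneg fun _ _ => sq_nonneg _
    rw [div_pow, one_pow, Real.sq_sqrt hlam.le, le_div_iff₀ hlam]
    nlinarith

end Kernel

/-! ### Deterministic comparison of the limit with ridge regression. -/

section Comparison

variable {m d : ℕ} {ι : Type} [Fintype ι] {x : ι → EuclideanSpace ℝ (Fin d)} {y : ι → ℝ}
  {lam : ℝ} {a : Fin m → ℝ} {W₀ : Weights m d}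

theorem abs_sum_mul_le {v w : ι → ℝ} {S T : ℝ} (hS : 0 ≤ S) (hT : 0 ≤ T)
    (hv : ∑ j, v j ^ 2 ≤ S ^ 2) (hw : ∑ j, w j ^ 2 ≤ T ^ 2) : |∑ j, v j * w j| ≤ S * T := by
  refine (Finset.abs_sum_le_sum_abs _ _).trans ?_
  simp only [abs_mul]
  refine (sum_mul_le_of_sum_sq_le hS hv).trans (mul_le_mul_of_nonneg_left ?_ hS)
  rwa [Real.sqrt_le_left hT]

theorem abs_ntkPredictor_le [DecidableEq ι] (hlam : 0 < lam) (hy : ∀ i, |y i| ≤ 1) {N : ℝ}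
    (hN : (Fintype.card ι : ℝ) ≤ N) {z : EuclideanSpace ℝ (Fin d)} (hz : ‖z‖ = 1) :
    |ntkPredictor x y lam z| ≤ Real.sqrt N / Real.sqrt lam := by
  obtain ⟨q, -, hq, hq2⟩ := exists_ridge_weights x hlam hz
  have hN0 : 0 ≤ N := le_trans (by positivity) hN
  have hy2 : ∑ j, y j ^ 2 ≤ Real.sqrt N ^ 2 := by
    rw [Real.sq_sqrt hN0]
    refine le_trans (Finset.sum_le_sum (g := fun _ => (1 : ℝ)) fun j _ => ?_) (by simpa using hN)
    rw [← sq_abs]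
    exact pow_le_one₀ (abs_nonneg _) (hy j)
  rw [hq y]
  refine (abs_sum_mul_le (by positivity) (by positivity) hq2 hy2).trans (le_of_eq ?_)
  ring

/-- The total deviation of the training dynamics from kernel regression. -/
noncomputable def totalDrift (m : ℕ) (lam R S N P F : ℝ) : ℝ :=
  S * (2 * Real.sqrt N * P + F) + lam * (Real.sqrt m * P * R)

theorem driftBound_le_totalDrift {K : EuclideanSpace ℝ (Fin d) → EuclideanSpace ℝ (Fin d) → ℝ}
    (hlam : 0 < lam) {R S N P F : ℝ} (hS0 : 0 ≤ S) (hR0 : 0 ≤ R) (hF0 : 0 ≤ F) (hN1 : 1 ≤ N)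
    (hP : ∑ j, flipFraction W₀ R (x j) ≤ P) {z : EuclideanSpace ℝ (Fin d)}
    (hPz : flipFraction W₀ R z ≤ P)
    (hF : ∑ k, (empKernel W₀ z (x k) - K z (x k)) ^ 2 ≤ F ^ 2) :
    driftBound K x lam W₀ R S N z ≤ totalDrift m lam R S N P F := by
  unfold driftBound totalDrift
  have h1 : (1 : ℝ) ≤ Real.sqrt N := Real.one_le_sqrt.2 hN1
  have h2 := (Real.sqrt_le_left hF0).2 hF
  have h3 := flipFraction_nonneg W₀ R z
  have hP0 : 0 ≤ P := h3.trans hPz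
  have h4 : P ≤ Real.sqrt N * P := le_mul_of_one_le_left hP0 h1
  have h5 : Real.sqrt N * flipFraction W₀ R z ≤ Real.sqrt N * P := by gcongr
  refine add_le_add (mul_le_mul_of_nonneg_left (by linarith) hS0) ?_
  gcongr

/-- Bounding every drift by the total one would cost ∑|q j|, hence an extra √N. This is avoided
because P and F already control the flip fractions and kernel errors summed over the training
points. -/
theorem sum_abs_mul_driftBound_le
    {K : EuclideanSpace ℝ (Fin d) → EuclideanSpace ℝ (Fin d) → ℝ}
    (hlam : 0 < lam) {R S N P F Q : ℝ} (hS0 : 0 ≤ S) (hR0 : 0 ≤ R) (hF0 : 0 ≤ F) (hQ0 : 0 ≤ Q)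
    (hN : (Fintype.card ι : ℝ) ≤ N) (hP : ∑ j, flipFraction W₀ R (x j) ≤ P)
    (hF : ∑ j, ∑ k, (empKernel W₀ (x j) (x k) - K (x j) (x k)) ^ 2 ≤ F ^ 2)
    {q : ι → ℝ} (hq : ∑ j, q j ^ 2 ≤ Q ^ 2) :
    ∑ j, |q j| * driftBound K x lam W₀ R S N (x j) ≤ Q * totalDrift m lam R S N P F := by
  set p : ι → ℝ := fun j => flipFraction W₀ R (x j) with hp
  set e : ι → ℝ := fun j => Real.sqrt (∑ k, (empKernel W₀ (x j) (x k) - K (x j) (x k)) ^ 2)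
    with he
  have hp0 : ∀ j, 0 ≤ p j := fun j => flipFraction_nonneg _ _ _
  have hP0 : 0 ≤ P := (Finset.sum_nonneg fun j _ => hp0 j).trans hP
  have e1 : ∑ j, |q j| * driftBound K x lam W₀ R S N (x j)
      = (S * Real.sqrt N + lam * (Real.sqrt m * R)) * ∑ j, |q j| * p j
        + (S * ∑ k, p k) * ∑ j, |q j| + S * ∑ j, |q j| * e j := by
    have hlin : ∀ A B C : ℝ, A * ∑ j, |q j| * p j + B * ∑ j, |q j| + C * ∑ j, |q j| * e j
        = ∑ j, |q j| * (A * p j + B + C * e j) := by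
      intro A B C
      rw [Finset.mul_sum, Finset.mul_sum, Finset.mul_sum, ← Finset.sum_add_distrib,
        ← Finset.sum_add_distrib]
      exact Finset.sum_congr rfl fun j _ => by ring
    rw [hlin]
    refine Finset.sum_congr rfl fun j _ => ?_
    simp only [driftBound, hp, he]
    ring
  have b1 : ∑ j, |q j| * p j ≤ Q * P := by
    have : ∑ j, |q j| * p j ≤ ∑ j, Q * p j :=
      Finset.sum_le_sum fun j _ =>
        mul_le_mul_of_nonneg_right (abs_le_of_sum_sq_le hQ0 hq j) (hp0 j)
    rw [← Finset.mul_sum] at this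
    exact this.trans (mul_le_mul_of_nonneg_left hP hQ0)
  have b2 : ∑ j, |q j| ≤ Real.sqrt N * Q := sum_abs_le_of_sum_sq_le hQ0 hN hq
  have b3 : ∑ j, |q j| * e j ≤ Q * F := by
    have := sum_mul_le_of_sum_sq_le (w := e) hQ0 hq
    have h1 : ∀ j, |e j| = e j := fun j => abs_of_nonneg (Real.sqrt_nonneg _)
    simp only [h1] at this
    refine this.trans (mul_le_mul_of_nonneg_left ?_ hQ0)
    rw [Real.sqrt_le_left hF0]
    refine le_trans (le_of_eq ?_) hF
    exact Finset.sum_congr rfl fun j _ =>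
      Real.sq_sqrt (Finset.sum_nonneg fun _ _ => sq_nonneg _)
  rw [e1]
  have c1 : (S * Real.sqrt N + lam * (Real.sqrt m * R)) * ∑ j, |q j| * p j
      ≤ (S * Real.sqrt N + lam * (Real.sqrt m * R)) * (Q * P) :=
    mul_le_mul_of_nonneg_left b1 (by positivity)
  have c2 : (S * ∑ k, p k) * ∑ j, |q j| ≤ (S * P) * (Real.sqrt N * Q) :=
    mul_le_mul (mul_le_mul_of_nonneg_left hP hS0) b2
      (Finset.sum_nonneg fun _ _ => abs_nonneg _) (by positivity)
  have c3 : S * ∑ j, |q j| * e j ≤ S * (Q * F) := mul_le_mul_of_nonneg_left b3 hS0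
  unfold totalDrift
  linarith

/-- Deterministic comparison of the trained network with kernel ridge regression. -/
theorem IsTrainedNetwork.abs_sub_ntkPredictor_le [DecidableEq ι]
    {f : EuclideanSpace ℝ (Fin d) → ℝ} (h : IsTrainedNetwork x y lam a W₀ f) (hm : 0 < m)
    (ha : ∀ r, |a r| = 1) (hx : ∀ j, ‖x j‖ = 1) (hlam : 0 < lam) {R S N P F U : ℝ}
    (hS0 : 0 ≤ S) (hF0 : 0 ≤ F) (hU0 : 0 ≤ U)
    (hN1 : 1 ≤ N) (hN : (Fintype.card ι : ℝ) ≤ N)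
    (hS : ∑ j, (y j - network a W₀ (x j)) ^ 2 ≤ S ^ 2)
    (hR : (1 / Real.sqrt m) * (Real.sqrt N * S) / lam ≤ R)
    (hU : ∑ j, network a W₀ (x j) ^ 2 ≤ U ^ 2)
    (hP : ∑ j, flipFraction W₀ R (x j) ≤ P)
    (hF : ∑ j, ∑ k, (empKernel W₀ (x j) (x k) - ntk (x j) (x k)) ^ 2 ≤ F ^ 2)
    {z : EuclideanSpace ℝ (Fin d)} (hz : ‖z‖ = 1) (hPz : flipFraction W₀ R z ≤ P)
    (hFz : ∑ k, (empKernel W₀ z (x k) - ntk z (x k)) ^ 2 ≤ F ^ 2) :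
    |f z - ntkPredictor x y lam z| ≤ |network a W₀ z|
      + (1 / Real.sqrt lam) * (U + totalDrift m lam R S N P F / lam)
      + totalDrift m lam R S N P F / lam := by
  obtain ⟨W, hW, hf⟩ := h
  obtain ⟨q, hq, hpred, hq2⟩ := exists_ridge_weights x hlam hz
  have hR0 : 0 ≤ R := le_trans (by positivity) hR
  set H := totalDrift m lam R S N P F with hH
  have hlim := fun {z : EuclideanSpace ℝ (Fin d)} (hz : ‖z‖ = 1) =>
    hW.abs_limit_le ntk hm ha hx hlam hS0 hN hS hR hf hz
  set ρ : ι → ℝ := fun k => y k - f (x k) with hρ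
  set η : EuclideanSpace ℝ (Fin d) → ℝ := fun v =>
    ∑ k, ntk v (x k) * ρ k - lam * (f v - network a W₀ v) with hη
  have hηz : |η z| ≤ H := (hlim hz).trans
    (driftBound_le_totalDrift hlam hS0 hR0 hF0 hN1 hP hPz hFz)
  have hηq : |∑ j, q j * η (x j)| ≤ (1 / Real.sqrt lam) * H := by
    refine (Finset.abs_sum_le_sum_abs _ _).trans ?_
    refine le_trans (Finset.sum_le_sum fun j _ => ?_)
      (sum_abs_mul_driftBound_le hlam hS0 hR0 hF0 (by positivity) hN hP hF hq2)
    rw [abs_mul]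
    exact mul_le_mul_of_nonneg_left (hlim (hx j)) (abs_nonneg _)
  have hqu : |∑ j, q j * network a W₀ (x j)| ≤ (1 / Real.sqrt lam) * U :=
    abs_sum_mul_le (by positivity) hU0 hq2 hU
  -- Substitute K_z = (K_tr + λ)q, move the symmetric K_tr onto the residual, and insert the
  -- approximate normal equations at the training points; the values f (x k) cancel.
  have e1 : ∑ k, ntk z (x k) * ρ k
      = lam * ∑ j, q j * y j - lam * ∑ j, q j * network a W₀ (x j) + ∑ j, q j * η (x j) := by
    have h1 : ∑ k, ntk z (x k) * ρ k
        = ∑ k, q k * (∑ j, ntk (x k) (x j) * ρ j) + lam * ∑ k, q k * ρ k := by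
      simp only [← hq, add_mul, Finset.sum_add_distrib, Finset.sum_mul, Finset.mul_sum]
      congr 1
      · rw [Finset.sum_comm]
        refine Finset.sum_congr rfl fun k _ => Finset.sum_congr rfl fun j _ => ?_
        rw [ntk_comm (x j) (x k)]
        ring
      · exact Finset.sum_congr rfl fun k _ => by ring
    rw [h1]
    simp only [Finset.mul_sum (s := Finset.univ) (a := lam), ← Finset.sum_sub_distrib,
      ← Finset.sum_add_distrib]
    refine Finset.sum_congr rfl fun k _ => ?_
    simp only [hη, hρ]
    ring
  have e2 : f z - ntkPredictor x y lam z = network a W₀ z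
      + (-∑ j, q j * network a W₀ (x j) + (∑ j, q j * η (x j)) / lam) + (- η z / lam) := by
    have : η z = ∑ k, ntk z (x k) * ρ k - lam * (f z - network a W₀ z) := rfl
    rw [hpred y, this, e1]
    field_simp
    ring
  rw [e2]
  refine (abs_add_three _ _ _).trans ?_
  have h3 : |-∑ j, q j * network a W₀ (x j) + (∑ j, q j * η (x j)) / lam|
      ≤ (1 / Real.sqrt lam) * (U + H / lam) := by
    refine (abs_add_le _ _).trans ?_
    rw [abs_neg, mul_add, abs_div, abs_of_pos hlam, mul_div_assoc']
    gcongr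
  have h4 : |-η z / lam| ≤ H / lam := by
    rw [abs_div, abs_of_pos hlam, abs_neg]
    gcongr
  linarith

/-- The energy estimate keeps the Frobenius displacement below S/√λ at all times, and the resulting
bound passes to the limit. -/
theorem IsTrainedNetwork.abs_le {f : EuclideanSpace ℝ (Fin d) → ℝ}
    (h : IsTrainedNetwork x y lam a W₀ f) (ha : ∀ r, |a r| = 1) (hlam : 0 < lam) {S : ℝ}
    (hS0 : 0 ≤ S) (hS : ∑ j, (y j - network a W₀ (x j)) ^ 2 ≤ S ^ 2)
    {z : EuclideanSpace ℝ (Fin d)} (hz : ‖z‖ = 1) :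
    |f z| ≤ |network a W₀ z| + S / Real.sqrt lam := by
  obtain ⟨W, hW, hf⟩ := h
  refine le_of_tendsto (hf z).abs ?_
  filter_upwards [eventually_ge_atTop 0] with t ht
  have h1 := hW.abs_network_sub_le ha hlam hS0 hS ht hz
  have h2 := abs_sub_abs_le_abs_sub (network a (W t) z) (network a W₀ z)
  linarith

end Comparison

end WideReLU

namespace WideReLU

/-! ### Fourth moments of sub-Gaussian and Rademacher sums. -/

section Moments

theorem pow_four_le_exp (x : ℝ) : x ^ 4 ≤ 24 * (Real.exp x + Real.exp (-x)) := by
  have key : ∀ u : ℝ, 0 ≤ u → u ^ 4 ≤ 24 * Real.exp u := fun u hu => by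
    have := Real.pow_div_factorial_le_exp u hu 4
    norm_num [Nat.factorial] at this
    linarith
  rcases le_total 0 x with h | h
  · linarith [key x h, Real.exp_pos (-x)]
  · have := key (-x) (by linarith)
    rw [show (-x) ^ 4 = x ^ 4 by ring] at this
    linarith [Real.exp_pos x]

/-- A sub-Gaussian bound at `±1` bounds the fourth moment. -/
theorem lintegral_pow_four_le {Ω : Type*} [MeasurableSpace Ω] {μ : Measure Ω} {X : Ω → ℝ}
    (h₁ : Integrable (fun ω => Real.exp (X ω)) μ) (h₂ : Integrable (fun ω => Real.exp (-X ω)) μ)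
    (b₁ : ∫ ω, Real.exp (X ω) ∂μ ≤ Real.exp (1 / 2))
    (b₂ : ∫ ω, Real.exp (-X ω) ∂μ ≤ Real.exp (1 / 2)) :
    ∫⁻ ω, ENNReal.ofReal (X ω ^ 4) ∂μ ≤ ENNReal.ofReal 100 := by
  calc ∫⁻ ω, ENNReal.ofReal (X ω ^ 4) ∂μ
      ≤ ∫⁻ ω, ENNReal.ofReal (24 * (Real.exp (X ω) + Real.exp (-X ω))) ∂μ :=
        lintegral_mono fun ω => ENNReal.ofReal_le_ofReal (pow_four_le_exp _)
    _ = ENNReal.ofReal (∫ ω, 24 * (Real.exp (X ω) + Real.exp (-X ω)) ∂μ) :=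
        (ofReal_integral_eq_lintegral_ofReal ((h₁.add h₂).const_mul 24)
          (Eventually.of_forall fun ω =>
            mul_nonneg (by norm_num) (add_pos (Real.exp_pos _) (Real.exp_pos _)).le)).symm
    _ ≤ ENNReal.ofReal 100 := by
        refine ENNReal.ofReal_le_ofReal ?_
        rw [integral_const_mul, integral_add h₁ h₂]
        -- The constant 100 covers 24 · (2 + 2) = 96.
        have : Real.exp (1 / 2) ≤ 2 := by
          rw [← Real.le_log_iff_exp_le two_pos]
          linarith [Real.log_two_gt_d9]
        linarith

theorem uniformOn_pm_one : (uniformOn ({-1, 1} : Set ℝ) : Measure ℝ)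
    = (2⁻¹ : ENNReal) • (Measure.dirac (-1) + Measure.dirac 1) := by
  have hne : (-1 : ℝ) ≠ 1 := by norm_num
  have hc : Measure.count ({-1, 1} : Set ℝ) = 2 := by
    have := Measure.count_apply_finset ({-1, 1} : Finset ℝ)
    rw [Finset.card_pair hne] at this
    simpa using this
  have hr : (Measure.count : Measure ℝ).restrict {-1, 1}
      = Measure.dirac (-1) + Measure.dirac 1 := by
    rw [Set.insert_eq, Measure.restrict_union (by simpa using hne) (measurableSet_singleton _),
      Measure.restrict_singleton, Measure.restrict_singleton]
    simp
  rw [uniformOn, ProbabilityTheory.cond, hc, hr]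

instance : IsProbabilityMeasure (uniformOn ({-1, 1} : Set ℝ)) :=
  isProbabilityMeasure_uniformOn (by simp) (by simp)

theorem integrable_uniformOn_pm_one (f : ℝ → ℝ) :
    Integrable f (uniformOn ({-1, 1} : Set ℝ)) := by
  rw [uniformOn_pm_one]
  refine Integrable.smul_measure (Integrable.add_measure ?_ ?_) (by simp)
  · exact integrable_dirac (by simp)
  · exact integrable_dirac (by simp)

theorem integral_uniformOn_pm_one (f : ℝ → ℝ) :
    ∫ a, f a ∂(uniformOn ({-1, 1} : Set ℝ)) = (f (-1) + f 1) / 2 := by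
  rw [uniformOn_pm_one, integral_smul_measure, integral_add_measure
    (integrable_dirac (by simp)) (integrable_dirac (by simp)), integral_dirac, integral_dirac]
  simp
  ring

variable {m : ℕ}

/-- Independence factorizes the expectation, and cosh t ≤ exp(t²/2) bounds each factor. -/
theorem exp_rademacher_sum (t : Fin m → ℝ) :
    Integrable (fun a : Fin m → ℝ => Real.exp (∑ r, a r * t r))
      (Measure.pi fun _ => uniformOn ({-1, 1} : Set ℝ)) ∧
    ∫ a : Fin m → ℝ, Real.exp (∑ r, a r * t r) ∂(Measure.pi fun _ => uniformOn ({-1, 1} : Set ℝ))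
      ≤ Real.exp ((∑ r, t r ^ 2) / 2) := by
  simp only [Real.exp_sum]
  refine ⟨Integrable.fintype_prod (f := fun r a => Real.exp (a * t r))
    fun r => integrable_uniformOn_pm_one _, ?_⟩
  rw [integral_fintype_prod_eq_prod (f := fun r a => Real.exp (a * t r)), Finset.sum_div,
    Real.exp_sum]
  refine Finset.prod_le_prod (fun r _ => integral_nonneg fun _ => (Real.exp_pos _).le)
    fun r _ => ?_
  rw [integral_uniformOn_pm_one]
  refine le_trans (le_of_eq ?_) (Real.cosh_le_exp_half_sq (t r))
  rw [Real.cosh_eq]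
  simp only [neg_mul, one_mul]
  ring

/-- Khinchin's inequality for the fourth moment. -/
theorem lintegral_rademacher_sum_pow_four_le (c : Fin m → ℝ) :
    ∫⁻ a : Fin m → ℝ, ENNReal.ofReal ((∑ r, a r * c r) ^ 4)
      ∂(Measure.pi fun _ => uniformOn ({-1, 1} : Set ℝ))
      ≤ ENNReal.ofReal (100 * (∑ r, c r ^ 2) ^ 2) := by
  set T := ∑ r, c r ^ 2 with hT
  have hT0 : 0 ≤ T := Finset.sum_nonneg fun _ _ => sq_nonneg _
  rcases hT0.eq_or_lt with h | h
  · have hc : ∀ r, c r = 0 := fun r => by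
      have := (Finset.sum_eq_zero_iff_of_nonneg fun r _ => sq_nonneg (c r)).1 (hT ▸ h.symm) r
        (Finset.mem_univ r)
      exact pow_eq_zero_iff two_ne_zero |>.1 this
    simp [hc]
  · have hs : 0 < Real.sqrt T := Real.sqrt_pos.2 h
    have hss : Real.sqrt T ^ 2 = T := Real.sq_sqrt hT0
    -- After division by √T the sum has unit variance proxy; ε = ±1 gives the two exponential
    -- moments required.
    have e : ∀ ε : ℝ, ε ^ 2 = 1 → (∑ r, (ε * c r / Real.sqrt T) ^ 2) / 2 = 1 / 2 := by
      intro ε hε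
      simp only [div_pow, mul_pow, hε, one_mul, ← Finset.sum_div, hss]
      rw [← hT, div_self h.ne']
    obtain ⟨i1, b1⟩ := exp_rademacher_sum fun r => 1 * c r / Real.sqrt T
    obtain ⟨i2, b2⟩ := exp_rademacher_sum fun r => -1 * c r / Real.sqrt T
    rw [e _ (by norm_num)] at b1 b2
    have e1 : ∀ a : Fin m → ℝ, ∑ r, a r * (1 * c r / Real.sqrt T)
        = (∑ r, a r * c r) / Real.sqrt T := fun a => by
      rw [Finset.sum_div]; exact Finset.sum_congr rfl fun r _ => by ring
    have e2 : ∀ a : Fin m → ℝ, ∑ r, a r * (-1 * c r / Real.sqrt T)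
        = -((∑ r, a r * c r) / Real.sqrt T) := fun a => by
      rw [Finset.sum_div, ← Finset.sum_neg_distrib]
      exact Finset.sum_congr rfl fun r _ => by ring
    simp only [e1, e2] at i1 i2 b1 b2
    have := lintegral_pow_four_le i1 i2 b1 b2
    have e3 : ∀ a : Fin m → ℝ, ENNReal.ofReal ((∑ r, a r * c r) ^ 4)
        = ENNReal.ofReal (T ^ 2) * ENNReal.ofReal (((∑ r, a r * c r) / Real.sqrt T) ^ 4) := by
      intro a
      rw [← ENNReal.ofReal_mul (by positivity), div_pow,
        show Real.sqrt T ^ 4 = T ^ 2 by nth_rewrite 2 [← hss]; ring]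
      congr 1
      field_simp
    simp only [e3]
    rw [lintegral_const_mul' _ _ (by simp)]
    refine (mul_le_mul_right this _).trans (le_of_eq ?_)
    rw [← ENNReal.ofReal_mul (by positivity), mul_comm]

end Moments

/-! ### One Gaussian weight: moments, small balls, scaling. -/

section Gaussian

variable {d : ℕ}

theorem map_inner_stdGaussian {z : EuclideanSpace ℝ (Fin d)} (hz : ‖z‖ = 1) :
    (stdGaussian (EuclideanSpace ℝ (Fin d))).map (fun w => inner ℝ w z) = gaussianReal 0 1 := by
  have h := IsGaussian.map_eq_gaussianReal (μ := stdGaussian (EuclideanSpace ℝ (Fin d)))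
    (innerSL ℝ z)
  rw [variance_dual_stdGaussian, integral_strongDual_stdGaussian, innerSL_apply_norm, hz] at h
  simp only [one_pow, Real.toNNReal_one] at h
  rw [← h]
  congr 1
  ext w
  simp [real_inner_comm]

theorem lintegral_inner_pow_four_le {z : EuclideanSpace ℝ (Fin d)} (hz : ‖z‖ = 1) :
    ∫⁻ w, ENNReal.ofReal ((inner ℝ w z) ^ 4) ∂(stdGaussian (EuclideanSpace ℝ (Fin d)))
      ≤ ENNReal.ofReal 100 := by
  have h : ∫⁻ u, ENNReal.ofReal (u ^ 4) ∂(gaussianReal 0 1) ≤ ENNReal.ofReal 100 := by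
    have i1 := integrable_exp_mul_gaussianReal (μ := 0) (v := 1) 1
    have i2 := integrable_exp_mul_gaussianReal (μ := 0) (v := 1) (-1)
    have b := fun t => congrFun (mgf_fun_id_gaussianReal (μ := 0) (v := 1)) t
    have b1 := b 1
    have b2 := b (-1)
    simp only [mgf] at b1 b2
    simp only [one_mul, neg_mul] at i1 i2 b1 b2
    refine lintegral_pow_four_le i1 i2 (b1.trans (by norm_num)).le (b2.trans (by norm_num)).le
  rw [← map_inner_stdGaussian hz, lintegral_map (by fun_prop) (by fun_prop)] at h
  exact h

/-- The density is at most 1/2 because √(2π) ≥ 2, and the interval has length 2t. -/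
theorem gaussianReal_abs_le (t : ℝ) :
    gaussianReal 0 1 {u | |u| ≤ t} ≤ ENNReal.ofReal t := by
  rw [gaussianReal_apply _ one_ne_zero]
  have hset : {u : ℝ | |u| ≤ t} = Set.Icc (-t) t := by
    ext u; simp [abs_le]
  calc ∫⁻ u in {u | |u| ≤ t}, gaussianPDF 0 1 u
      ≤ ∫⁻ _ in {u : ℝ | |u| ≤ t}, ENNReal.ofReal (1 / 2) := by
        refine lintegral_mono fun u => ENNReal.ofReal_le_ofReal ?_
        rw [gaussianPDFReal]
        have h1 : Real.exp (-(u - 0) ^ 2 / (2 * ((1 : NNReal) : ℝ))) ≤ 1 := by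
          rw [Real.exp_le_one_iff]
          have := sq_nonneg (u - 0)
          simp only [NNReal.coe_one]
          linarith
        have h2 : 2 ≤ Real.sqrt (2 * Real.pi * ((1 : NNReal) : ℝ)) := by
          refine Real.le_sqrt_of_sq_le ?_
          simp only [NNReal.coe_one]
          linarith [Real.pi_gt_three]
        have h3 : (Real.sqrt (2 * Real.pi * ((1 : NNReal) : ℝ)))⁻¹ ≤ 1 / 2 := by
          rw [one_div]; exact inv_anti₀ two_pos h2
        exact (mul_le_mul h3 h1 (Real.exp_pos _).le (by norm_num)).trans (by norm_num)
    _ = ENNReal.ofReal t := by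
        rw [setLIntegral_const, hset, Real.volume_Icc, ← ENNReal.ofReal_mul (by norm_num)]
        congr 1
        ring

theorem measurable_flip (R : ℝ) : Measurable (flip R) :=
  Measurable.ite (measurableSet_le measurable_abs measurable_const)
    measurable_const measurable_const

/-- The law of one weight. -/
noncomputable def weightLaw (d : ℕ) (kappa : ℝ) : Measure (EuclideanSpace ℝ (Fin d)) :=
  (stdGaussian (EuclideanSpace ℝ (Fin d))).map fun w => kappa • w

theorem measurable_const_smul_weight (kappa : ℝ) :
    Measurable fun w : EuclideanSpace ℝ (Fin d) => kappa • w := by fun_prop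

instance (kappa : ℝ) : IsProbabilityMeasure (weightLaw d kappa) :=
  Measure.isProbabilityMeasure_map (measurable_const_smul_weight kappa).aemeasurable

theorem lintegral_weightLaw_pow_four_le {kappa : ℝ} {z : EuclideanSpace ℝ (Fin d)}
    (hz : ‖z‖ = 1) : ∫⁻ w, ENNReal.ofReal ((inner ℝ w z) ^ 4) ∂(weightLaw d kappa)
      ≤ ENNReal.ofReal (100 * kappa ^ 4) := by
  rw [weightLaw, lintegral_map (by fun_prop) (measurable_const_smul_weight kappa)]
  have e : ∀ w : EuclideanSpace ℝ (Fin d), ENNReal.ofReal ((inner ℝ (kappa • w) z) ^ 4)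
      = ENNReal.ofReal (kappa ^ 4) * ENNReal.ofReal ((inner ℝ w z) ^ 4) := fun w => by
    rw [inner_smul_left, ← ENNReal.ofReal_mul (by positivity)]
    simp [mul_pow]
  simp only [e]
  rw [lintegral_const_mul' _ _ (by simp), mul_comm 100, ENNReal.ofReal_mul (by positivity)]
  exact mul_le_mul_right (lintegral_inner_pow_four_le hz) _

theorem lintegral_flip_weightLaw_le {kappa R : ℝ} (hk : 0 < kappa)
    {z : EuclideanSpace ℝ (Fin d)} (hz : ‖z‖ = 1) :
    ∫⁻ w, ENNReal.ofReal (flip R (inner ℝ w z)) ∂(weightLaw d kappa)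
      ≤ ENNReal.ofReal (R / kappa) := by
  have hm : Measurable fun w : EuclideanSpace ℝ (Fin d) =>
      ENNReal.ofReal (flip R (inner ℝ w z)) :=
    ENNReal.measurable_ofReal.comp ((measurable_flip R).comp (by fun_prop))
  rw [weightLaw, lintegral_map hm (measurable_const_smul_weight kappa)]
  refine le_trans (le_of_eq ?_) (gaussianReal_abs_le (R / kappa))
  have hset : MeasurableSet {u : ℝ | |u| ≤ R / kappa} :=
    measurableSet_le measurable_abs measurable_const
  rw [← map_inner_stdGaussian hz, Measure.map_apply (by fun_prop) hset,
    ← lintegral_indicator_one (hset.preimage (by fun_prop))]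
  refine lintegral_congr fun w => ?_
  have h1 : |inner ℝ (kappa • w) z| ≤ R ↔ |inner ℝ w z| ≤ R / kappa := by
    rw [inner_smul_left, abs_mul, le_div_iff₀ hk, mul_comm]
    simp [abs_of_pos hk]
  unfold flip
  by_cases h : |inner ℝ w z| ≤ R / kappa
  · simp [h1.2 h, h, Set.indicator]
  · simp [h1.not.2 h, h, Set.indicator]

/-- Gates are invariant under positive scaling of the weight, so the initialization scale does not
enter the kernel. -/
theorem integral_step_weightLaw {kappa : ℝ} (hk : 0 < kappa) (z z' : EuclideanSpace ℝ (Fin d)) :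
    ∫ w, step (inner ℝ w z) * step (inner ℝ w z') * inner ℝ z z' ∂(weightLaw d kappa)
      = ntk z z' := by
  have hm : Measurable fun w : EuclideanSpace ℝ (Fin d) =>
      step (inner ℝ w z) * step (inner ℝ w z') * inner ℝ z z' :=
    ((measurable_step_inner z).mul (measurable_step_inner z')).mul_const _
  rw [weightLaw, integral_map (measurable_const_smul_weight kappa).aemeasurable
    hm.aestronglyMeasurable, ntk_eq_integral]
  congr 1
  ext w
  have h : ∀ v : EuclideanSpace ℝ (Fin d), step (inner ℝ (kappa • w) v) = step (inner ℝ w v) := by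
    intro v
    unfold step
    rw [inner_smul_left]
    simp [mul_nonneg_iff_of_pos_left hk]
  rw [h, h]

end Gaussian

end WideReLU

/-! ### The random initialization and its good event. -/

namespace WideReLU

variable {m d : ℕ}

theorem initLaw_eq (m d : ℕ) (kappa : ℝ) : initLaw m d kappa
    = (Measure.pi fun _ => uniformOn ({-1, 1} : Set ℝ)).prod
      (Measure.pi fun _ => weightLaw d kappa) := rfl

instance (kappa : ℝ) : IsProbabilityMeasure (initLaw m d kappa) := by
  rw [initLaw_eq]; infer_instance

theorem measurable_inner_weight (r : Fin m) (z : EuclideanSpace ℝ (Fin d)) :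
    Measurable fun W : Weights m d => inner ℝ (W r) z :=
  (show Measurable fun w : EuclideanSpace ℝ (Fin d) => inner ℝ w z by fun_prop).comp
    (measurable_pi_apply r)

theorem measurable_network (z : EuclideanSpace ℝ (Fin d)) :
    Measurable fun θ : (Fin m → ℝ) × Weights m d => network θ.1 θ.2 z := by
  unfold network
  refine (Finset.measurable_fun_sum _ fun r _ => ?_).const_mul _
  exact ((measurable_pi_apply r).comp measurable_fst).mul
    (measurable_const.max ((measurable_inner_weight r z).comp measurable_snd))

theorem measurable_flipFraction (R : ℝ) (z : EuclideanSpace ℝ (Fin d)) :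
    Measurable fun W : Weights m d => flipFraction W R z := by
  unfold flipFraction
  exact (Finset.measurable_fun_sum _ fun r _ =>
    (measurable_flip R).comp (measurable_inner_weight r z)).const_mul _

theorem measurable_empKernel (z z' : EuclideanSpace ℝ (Fin d)) :
    Measurable fun W : Weights m d => empKernel W z z' := by
  unfold empKernel
  exact (Finset.measurable_fun_sum _ fun r _ =>
    ((measurable_step.comp (measurable_inner_weight r z)).mul
      (measurable_step.comp (measurable_inner_weight r z'))).mul_const _).const_mul _

theorem lintegral_initLaw_snd (kappa : ℝ) {f : Weights m d → ENNReal} (hf : Measurable f) :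
    ∫⁻ θ, f θ.2 ∂(initLaw m d kappa) = ∫⁻ W, f W ∂(Measure.pi fun _ => weightLaw d kappa) := by
  rw [initLaw_eq, ← lintegral_map hf measurable_snd]
  congr 1
  exact Measure.snd_prod

theorem lintegral_weight_eval (kappa : ℝ) (r : Fin m) {f : EuclideanSpace ℝ (Fin d) → ENNReal}
    (hf : Measurable f) :
    ∫⁻ W : Weights m d, f (W r) ∂(Measure.pi fun _ => weightLaw d kappa)
      = ∫⁻ w, f w ∂(weightLaw d kappa) :=
  (measurePreserving_eval (fun _ : Fin m => weightLaw d kappa) r).lintegral_comp hf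

theorem lintegral_sum_ofReal_le {Ω J : Type*} [MeasurableSpace Ω] [Fintype J] {μ : Measure Ω}
    {f : J → Ω → ℝ} {b : ℝ} (hf : ∀ j, Measurable (f j)) (h0 : ∀ j ω, 0 ≤ f j ω)
    (hb0 : 0 ≤ b) (hb : ∀ j, ∫⁻ ω, ENNReal.ofReal (f j ω) ∂μ ≤ ENNReal.ofReal b) :
    ∫⁻ ω, ENNReal.ofReal (∑ j, f j ω) ∂μ ≤ ENNReal.ofReal (Fintype.card J * b) := by
  have e : ∀ ω, ENNReal.ofReal (∑ j, f j ω) = ∑ j, ENNReal.ofReal (f j ω) := fun ω =>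
    ENNReal.ofReal_sum_of_nonneg fun j _ => h0 j ω
  simp only [e]
  rw [lintegral_finsetSum _ fun j _ => (hf j).ennreal_ofReal]
  refine (Finset.sum_le_sum fun j _ => hb j).trans (le_of_eq ?_)
  rw [← ENNReal.ofReal_sum_of_nonneg fun _ _ => hb0]
  simp

/-- Khinchin's inequality in the signs, for fixed weights, then Cauchy–Schwarz over neurons and the
Gaussian fourth moment: each of the two moment bounds contributes a factor 100, and the width
cancels. -/
theorem lintegral_network_pow_four_le (hm : 0 < m) {kappa : ℝ} {z : EuclideanSpace ℝ (Fin d)}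
    (hz : ‖z‖ = 1) :
    ∫⁻ θ, ENNReal.ofReal (network θ.1 θ.2 z ^ 4) ∂(initLaw m d kappa)
      ≤ ENNReal.ofReal (10000 * kappa ^ 4) := by
  have hm' : (0 : ℝ) < m := by exact_mod_cast hm
  rw [initLaw_eq, lintegral_prod_symm' _ ((measurable_network z).pow_const 4).ennreal_ofReal]
  have hs : (1 / Real.sqrt m) ^ 4 = 1 / (m : ℝ) ^ 2 := by
    rw [div_pow, one_pow, show Real.sqrt m ^ 4 = (Real.sqrt m ^ 2) ^ 2 by ring,
      Real.sq_sqrt hm'.le]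
  have h1 : ∀ W : Weights m d, ∫⁻ a, ENNReal.ofReal (network a W z ^ 4)
      ∂(Measure.pi fun _ => uniformOn ({-1, 1} : Set ℝ))
      ≤ ENNReal.ofReal (100 / m) * ENNReal.ofReal (∑ r, (inner ℝ (W r) z) ^ 4) := by
    intro W
    have e : ∀ a : Fin m → ℝ, ENNReal.ofReal (network a W z ^ 4) = ENNReal.ofReal (1 / m ^ 2)
        * ENNReal.ofReal ((∑ r, a r * max 0 (inner ℝ (W r) z)) ^ 4) := by
      intro a
      rw [← ENNReal.ofReal_mul (by positivity), network, mul_pow, hs]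
    simp only [e]
    rw [lintegral_const_mul' _ _ (by simp)]
    refine (mul_le_mul_right (lintegral_rademacher_sum_pow_four_le _) _).trans ?_
    rw [← ENNReal.ofReal_mul (by positivity), ← ENNReal.ofReal_mul (by positivity)]
    refine ENNReal.ofReal_le_ofReal ?_
    have h2 : (∑ r, max 0 (inner ℝ (W r) z) ^ 2) ^ 2 ≤ m * ∑ r, (inner ℝ (W r) z) ^ 4 := by
      have := sq_sum_le_card_mul_sum_sq (s := (Finset.univ : Finset (Fin m)))
        (f := fun r => max 0 (inner ℝ (W r) z) ^ 2)
      rw [Finset.card_univ, Fintype.card_fin] at this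
      refine this.trans (mul_le_mul_of_nonneg_left (Finset.sum_le_sum fun r _ => ?_) hm'.le)
      rw [← pow_mul]
      rcases le_total 0 (inner ℝ (W r) z) with h | h
      · rw [max_eq_right h]
      · rw [max_eq_left h]; norm_num; positivity
    calc 1 / (m : ℝ) ^ 2 * (100 * (∑ r, max 0 (inner ℝ (W r) z) ^ 2) ^ 2)
        ≤ 1 / (m : ℝ) ^ 2 * (100 * (m * ∑ r, (inner ℝ (W r) z) ^ 4)) := by gcongr
      _ = 100 / m * ∑ r, (inner ℝ (W r) z) ^ 4 := by field_simp
  refine (lintegral_mono h1).trans ?_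
  rw [lintegral_const_mul' _ _ (by simp)]
  have h3 := lintegral_sum_ofReal_le (μ := Measure.pi fun _ : Fin m => weightLaw d kappa)
    (f := fun r (W : Weights m d) => (inner ℝ (W r) z) ^ 4) (b := 100 * kappa ^ 4)
    (fun r => (measurable_inner_weight r z).pow_const 4) (fun r W => by positivity)
    (by positivity) (fun r => by
      rw [lintegral_weight_eval kappa r
        (f := fun w => ENNReal.ofReal ((inner ℝ w z) ^ 4)) (by fun_prop)]
      exact lintegral_weightLaw_pow_four_le hz)
  refine (mul_le_mul_right h3 _).trans (le_of_eq ?_)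
  rw [← ENNReal.ofReal_mul (by positivity), Fintype.card_fin]
  congr 1
  field_simp
  ring

theorem lintegral_flipFraction_le (hm : 0 < m) {kappa R : ℝ} (hk : 0 < kappa) (hR : 0 ≤ R)
    {z : EuclideanSpace ℝ (Fin d)} (hz : ‖z‖ = 1) :
    ∫⁻ θ, ENNReal.ofReal (flipFraction θ.2 R z) ∂(initLaw m d kappa)
      ≤ ENNReal.ofReal (R / kappa) := by
  have hm' : (0 : ℝ) < m := by exact_mod_cast hm
  rw [lintegral_initLaw_snd kappa (f := fun W => ENNReal.ofReal (flipFraction W R z))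
    (measurable_flipFraction R z).ennreal_ofReal]
  unfold flipFraction
  simp only [ENNReal.ofReal_mul (show (0 : ℝ) ≤ 1 / m by positivity)]
  rw [lintegral_const_mul' _ _ (by simp)]
  have h3 := lintegral_sum_ofReal_le (μ := Measure.pi fun _ : Fin m => weightLaw d kappa)
    (f := fun r (W : Weights m d) => flip R (inner ℝ (W r) z)) (b := R / kappa)
    (fun r => (measurable_flip R).comp (measurable_inner_weight r z))
    (fun r W => flip_nonneg _ _) (by positivity) (fun r => by
      rw [lintegral_weight_eval kappa r (f := fun w => ENNReal.ofReal (flip R (inner ℝ w z)))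
        ((measurable_flip R).comp (by fun_prop)).ennreal_ofReal]
      exact lintegral_flip_weightLaw_le hk hz)
  refine (mul_le_mul_right h3 _).trans (le_of_eq ?_)
  rw [← ENNReal.ofReal_mul (by positivity), Fintype.card_fin]
  congr 1
  field_simp

/-- The empirical kernel is a mean of m independent copies of a variable in [−1, 1] with expectation
`ntk z z'`, so the left side is its variance. -/
theorem lintegral_empKernel_sub_sq_le (hm : 0 < m) {kappa : ℝ} (hk : 0 < kappa)
    {z z' : EuclideanSpace ℝ (Fin d)} (hz : ‖z‖ = 1) (hz' : ‖z'‖ = 1) :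
    ∫⁻ θ, ENNReal.ofReal ((empKernel θ.2 z z' - ntk z z') ^ 2) ∂(initLaw m d kappa)
      ≤ ENNReal.ofReal (1 / m) := by
  have hm' : (0 : ℝ) < m := by exact_mod_cast hm
  rw [lintegral_initLaw_snd kappa (f := fun W => ENNReal.ofReal ((empKernel W z z' - ntk z z') ^ 2))
    (((measurable_empKernel z z').sub_const _).pow_const 2).ennreal_ofReal]
  set Y : EuclideanSpace ℝ (Fin d) → ℝ := fun w =>
    step (inner ℝ w z) * step (inner ℝ w z') * inner ℝ z z' with hY
  have hYm : Measurable Y :=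
    ((measurable_step_inner z).mul (measurable_step_inner z')).mul_const _
  have hYb : ∀ w, |Y w| ≤ 1 := fun w => by
    rw [hY, abs_mul, abs_of_nonneg (mul_nonneg (step_nonneg _) (step_nonneg _))]
    refine mul_le_one₀ (mul_le_one₀ (step_le_one _) (step_nonneg _) (step_le_one _))
      (abs_nonneg _) ?_
    simpa [hz, hz'] using abs_real_inner_le_norm z z'
  set X : EuclideanSpace ℝ (Fin d) → ℝ := fun w => (1 / m) * Y w with hX
  have hXm : Measurable X := hYm.const_mul _
  have hXb : ∀ w, |X w| ≤ 1 / m := fun w => by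
    rw [hX, abs_mul, abs_of_nonneg (by positivity)]
    exact mul_le_of_le_one_right (by positivity) (hYb w)
  have hXL : MemLp X 2 (weightLaw d kappa) :=
    MemLp.of_bound hXm.aestronglyMeasurable (1 / m) (Eventually.of_forall hXb)
  have hvar := variance_sum_pi (μ := fun _ : Fin m => weightLaw d kappa) (X := fun _ => X)
    fun _ => hXL
  have hemp : ∀ W : Weights m d, empKernel W z z' = (∑ r, fun W : Weights m d => X (W r)) W := by
    intro W
    rw [Finset.sum_apply, empKernel, Finset.mul_sum]
  have hmean : ∫ W, (∑ r, fun W : Weights m d => X (W r)) W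
      ∂(Measure.pi fun _ => weightLaw d kappa) = ntk z z' := by
    simp only [Finset.sum_apply]
    rw [integral_finsetSum]
    · have : ∀ r : Fin m, ∫ W : Weights m d, X (W r) ∂(Measure.pi fun _ => weightLaw d kappa)
          = 1 / m * ntk z z' := fun r => by
        rw [integral_comp_eval (μ := fun _ : Fin m => weightLaw d kappa) (i := r) (f := X)
            hXm.aestronglyMeasurable, ← integral_step_weightLaw hk z z',
          integral_const_mul]
      simp only [this, Finset.sum_const, Finset.card_univ, Fintype.card_fin, nsmul_eq_mul]
      field_simp
    · exact fun r _ => integrable_comp_eval (hXL.integrable one_le_two)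
  have hL2 : MemLp (∑ r, fun W : Weights m d => X (W r)) 2
      (Measure.pi fun _ => weightLaw d kappa) :=
    memLp_finsetSum' _ fun r _ => hXL.comp_measurePreserving (measurePreserving_eval _ r)
  have hle : Var[∑ r, fun W : Weights m d => X (W r); Measure.pi fun _ => weightLaw d kappa]
      ≤ 1 / m := by
    rw [hvar]
    have : ∀ r : Fin m, Var[X; weightLaw d kappa] ≤ (1 / m) ^ 2 := fun r => by
      refine (variance_le_sq_of_bounded (a := -(1 / m)) (b := 1 / m)
        (Eventually.of_forall fun w => abs_le.1 (hXb w)) hXm.aemeasurable).trans (le_of_eq ?_)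
      ring
    refine (Finset.sum_le_sum fun r _ => this r).trans (le_of_eq ?_)
    simp only [Finset.sum_const, Finset.card_univ, Fintype.card_fin, nsmul_eq_mul]
    field_simp
  refine le_trans (le_of_eq ?_) (ENNReal.ofReal_le_ofReal hle)
  rw [hL2.ofReal_variance_eq, evariance_eq_lintegral_ofReal, hmean]
  exact lintegral_congr fun W => by rw [hemp W]

/-- Markov's inequality for the complement of a good event. -/
theorem measure_lt_le {Ω : Type*} [MeasurableSpace Ω] {μ : Measure Ω} {f : Ω → ℝ} {b δ : ℝ}
    (hf : Measurable f) (hb : 0 < b) (hδ : 0 < δ)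
    (h : ∫⁻ ω, ENNReal.ofReal (f ω) ∂μ ≤ ENNReal.ofReal b) :
    μ {ω | b / δ < f ω} ≤ ENNReal.ofReal δ := by
  have hpos : 0 < b / δ := by positivity
  calc μ {ω | b / δ < f ω} ≤ μ {ω | ENNReal.ofReal (b / δ) ≤ ENNReal.ofReal (f ω)} :=
        measure_mono fun ω hω => ENNReal.ofReal_le_ofReal (le_of_lt hω)
    _ ≤ (∫⁻ ω, ENNReal.ofReal (f ω) ∂μ) / ENNReal.ofReal (b / δ) :=
        meas_ge_le_lintegral_div hf.ennreal_ofReal.aemeasurable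
          (by simpa using hpos) (by simp)
    _ ≤ ENNReal.ofReal b / ENNReal.ofReal (b / δ) := ENNReal.div_le_div_right h _
    _ = ENNReal.ofReal δ := by
        rw [← ENNReal.ofReal_div_of_pos hpos]
        congr 1
        field_simp

/-- With probability at least `1 - δ` the initialization is regular at the points `z`. -/
theorem exists_good_event {J : Type*} [Fintype J] [Nonempty J] (hm : 0 < m) {kappa delta R : ℝ}
    (hk : 0 < kappa) (hd0 : 0 < delta) (hR : 0 < R) (z : J → EuclideanSpace ℝ (Fin d))
    (hz : ∀ j, ‖z j‖ = 1) :
    ∃ G : Set ((Fin m → ℝ) × Weights m d), MeasurableSet G ∧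
      ENNReal.ofReal (1 - delta) ≤ initLaw m d kappa G ∧
      ∀ θ ∈ G, (∀ r, |θ.1 r| = 1) ∧
        ∑ j, network θ.1 θ.2 (z j) ^ 4
          ≤ Fintype.card J * (10000 * kappa ^ 4) / (delta / 3) ∧
        ∑ j, flipFraction θ.2 R (z j) ≤ Fintype.card J * (R / kappa) / (delta / 3) ∧
        ∑ p : J × J, (empKernel θ.2 (z p.1) (z p.2) - ntk (z p.1) (z p.2)) ^ 2
          ≤ Fintype.card (J × J) * (1 / m) / (delta / 3) := by
  have hm' : (0 : ℝ) < m := by exact_mod_cast hm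
  have hJ : (0 : ℝ) < Fintype.card J := by exact_mod_cast Fintype.card_pos
  have hJJ : (0 : ℝ) < Fintype.card (J × J) := by exact_mod_cast Fintype.card_pos
  set f₁ : (Fin m → ℝ) × Weights m d → ℝ := fun θ => ∑ j, network θ.1 θ.2 (z j) ^ 4 with hf₁
  set f₂ : (Fin m → ℝ) × Weights m d → ℝ := fun θ => ∑ j, flipFraction θ.2 R (z j) with hf₂
  set f₃ : (Fin m → ℝ) × Weights m d → ℝ := fun θ =>
    ∑ p : J × J, (empKernel θ.2 (z p.1) (z p.2) - ntk (z p.1) (z p.2)) ^ 2 with hf₃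
  have n₁ : ∀ j, Measurable fun θ : (Fin m → ℝ) × Weights m d => network θ.1 θ.2 (z j) ^ 4 :=
    fun j => (measurable_network (z j)).pow_const 4
  have n₂ : ∀ j, Measurable fun θ : (Fin m → ℝ) × Weights m d => flipFraction θ.2 R (z j) :=
    fun j => (measurable_flipFraction R (z j)).comp measurable_snd
  have n₃ : ∀ p : J × J, Measurable fun θ : (Fin m → ℝ) × Weights m d =>
      (empKernel θ.2 (z p.1) (z p.2) - ntk (z p.1) (z p.2)) ^ 2 := fun p =>
    (((measurable_empKernel (z p.1) (z p.2)).comp measurable_snd).sub_const _).pow_const 2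
  have m₁ : Measurable f₁ := Finset.measurable_fun_sum _ fun j _ => n₁ j
  have m₂ : Measurable f₂ := Finset.measurable_fun_sum _ fun j _ => n₂ j
  have m₃ : Measurable f₃ := Finset.measurable_fun_sum _ fun p _ => n₃ p
  -- Three Markov bounds share δ equally; the condition |a_r| = 1 fails only on a null set.
  have hd : 0 < delta / 3 := by positivity
  have P₁ := measure_lt_le m₁ (b := Fintype.card J * (10000 * kappa ^ 4)) (by positivity) hd
    (lintegral_sum_ofReal_le n₁ (fun j θ => by positivity) (by positivity)
      fun j => lintegral_network_pow_four_le hm (kappa := kappa) (hz j))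
  have P₂ := measure_lt_le m₂ (b := Fintype.card J * (R / kappa)) (by positivity) hd
    (lintegral_sum_ofReal_le n₂ (fun j θ => flipFraction_nonneg _ _ _) (by positivity)
      fun j => lintegral_flipFraction_le hm hk hR.le (hz j))
  have P₃ := measure_lt_le m₃ (b := Fintype.card (J × J) * (1 / m)) (by positivity) hd
    (lintegral_sum_ofReal_le n₃ (fun j θ => by positivity) (by positivity)
      fun p => lintegral_empKernel_sub_sq_le hm hk (hz p.1) (hz p.2))
  set A : Set ((Fin m → ℝ) × Weights m d) := {θ | ∀ r, |θ.1 r| = 1} with hA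
  have mA : MeasurableSet A := by
    rw [hA, Set.ofPred_forall]
    exact MeasurableSet.iInter fun r => measurableSet_eq_fun
      (measurable_abs.comp ((measurable_pi_apply r).comp measurable_fst)) measurable_const
  have PA : initLaw m d kappa Aᶜ = 0 := by
    have hae : ∀ᵐ θ ∂(initLaw m d kappa), ∀ r, |θ.1 r| = 1 := by
      rw [ae_all_iff]
      intro r
      have h1 : ∀ᵐ u ∂(uniformOn ({-1, 1} : Set ℝ)), |u| = 1 := by
        rw [uniformOn_pm_one, Measure.ae_ennreal_smul_measure_iff (by simp), ae_add_measure_iff]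
        simp [ae_dirac_eq]
      have hmp : MeasurePreserving (fun θ : (Fin m → ℝ) × Weights m d => θ.1 r)
          (initLaw m d kappa) (uniformOn ({-1, 1} : Set ℝ)) := by
        rw [initLaw_eq]
        exact (measurePreserving_eval (fun _ : Fin m => uniformOn ({-1, 1} : Set ℝ)) r).comp
          measurePreserving_fst
      exact hmp.quasiMeasurePreserving.ae h1
    exact hae
  set B₁ := {θ | Fintype.card J * (10000 * kappa ^ 4) / (delta / 3) < f₁ θ}
  set B₂ := {θ | Fintype.card J * (R / kappa) / (delta / 3) < f₂ θ}
  set B₃ := {θ | Fintype.card (J × J) * (1 / (m : ℝ)) / (delta / 3) < f₃ θ}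
  have mB : MeasurableSet (Aᶜ ∪ (B₁ ∪ (B₂ ∪ B₃))) :=
    mA.compl.union ((measurableSet_lt measurable_const m₁).union
      ((measurableSet_lt measurable_const m₂).union (measurableSet_lt measurable_const m₃)))
  refine ⟨(Aᶜ ∪ (B₁ ∪ (B₂ ∪ B₃)))ᶜ, mB.compl, ?_, ?_⟩
  · have hB : initLaw m d kappa (Aᶜ ∪ (B₁ ∪ (B₂ ∪ B₃))) ≤ ENNReal.ofReal delta := by
      calc initLaw m d kappa (Aᶜ ∪ (B₁ ∪ (B₂ ∪ B₃)))
          ≤ 0 + (ENNReal.ofReal (delta / 3)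
            + (ENNReal.ofReal (delta / 3) + ENNReal.ofReal (delta / 3))) :=
            (measure_union_le _ _).trans (add_le_add PA.le ((measure_union_le _ _).trans
              (add_le_add P₁ ((measure_union_le _ _).trans (add_le_add P₂ P₃)))))
        _ = ENNReal.ofReal delta := by
            rw [← ENNReal.ofReal_add hd.le hd.le, ← ENNReal.ofReal_add hd.le (by linarith),
              zero_add]
            congr 1
            ring
    rw [prob_compl_eq_one_sub mB, ENNReal.ofReal_sub _ hd0.le, ENNReal.ofReal_one]
    exact tsub_le_tsub_left hB _
  · intro θ hθ
    simp only [Set.mem_compl_iff, Set.mem_union, not_or, not_not] at hθ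
    exact ⟨hθ.1, not_lt.1 hθ.2.1, not_lt.1 hθ.2.2.1, not_lt.1 hθ.2.2.2⟩

end WideReLU

namespace WideReLU

/-! ### Parameter bookkeeping. -/

section Arithmetic

/-- `totalDrift` for the movement radius, flip count and kernel error of the good event. -/
theorem totalDrift_scaled_le {m : ℕ} (hm : 0 < m) {n lam kappa delta ρ : ℝ} (hn : 1 ≤ n)
    (hlam : 0 < lam) (hlamn : lam ≤ n) (hk0 : 0 < kappa) (hk1 : kappa ≤ 1) (hd0 : 0 < delta)
    (hρ : 1 ≤ ρ) {R P : ℝ}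
    (hR : R = 1 / Real.sqrt m * (Real.sqrt n * (Real.sqrt n * ρ)) / lam)
    (hP : P = 6 * n * R / (kappa * delta)) :
    n * ρ / lam ^ 2 * totalDrift m lam R (Real.sqrt n * ρ) n P (4 * n / (Real.sqrt m * delta))
      ≤ 22 * (n ^ 4 * ρ ^ 3 / (kappa * delta * lam ^ 3 * Real.sqrt m)) := by
  have hm' : (0 : ℝ) < m := by exact_mod_cast hm
  set s := Real.sqrt m with hs
  have hs0 : 0 < s := Real.sqrt_pos.2 hm'
  have hn0 : 0 < n := by linarith
  set w := Real.sqrt n with hw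
  have hww : w * w = n := Real.mul_self_sqrt hn0.le
  have hw0 : 0 ≤ w := Real.sqrt_nonneg _
  have hwn : w ≤ n := by
    rw [hw, Real.sqrt_le_left hn0.le]; nlinarith
  have hρ0 : 0 < ρ := by linarith
  have hR' : R = n * ρ / (lam * s) := by
    rw [hR, ← mul_assoc w, hww]; field_simp
  have h1 : w * ρ * (2 * w * P) = 12 * n ^ 3 * ρ ^ 2 / (kappa * delta * lam * s) := by
    have : w * ρ * (2 * w * P) = (w * w) * (2 * ρ * P) := by ring
    rw [this, hww, hP, hR']
    field_simp
    ring
  have h2 : lam * (s * P * R) = 6 * n ^ 3 * ρ ^ 2 / (kappa * delta * lam * s) := by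
    rw [hP, hR']
    field_simp
  have h3 : w * ρ * (4 * n / (s * delta)) ≤ n * ρ * (4 * n / (s * delta)) := by gcongr
  -- Relative to the flip terms, the kernel error carries the extra factor κ(λ/n)/ρ ≤ 1. The
  -- constants then add up to 12 + 6 + 4 = 22.
  have h4 : n * ρ / lam ^ 2 * (n * ρ * (4 * n / (s * delta)))
      = 4 * (n ^ 4 * ρ ^ 3 / (kappa * delta * lam ^ 3 * s)) * (kappa * (lam / n) / ρ) := by
    field_simp
  have h5 : kappa * (lam / n) / ρ ≤ 1 := by
    rw [div_le_one hρ0]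
    exact (mul_le_one₀ hk1 (by positivity) ((div_le_one hn0).2 hlamn)).trans hρ
  have h6 : 0 ≤ 4 * (n ^ 4 * ρ ^ 3 / (kappa * delta * lam ^ 3 * s)) := by positivity
  have h7 := mul_le_of_le_one_right h6 h5
  rw [← h4] at h7
  have h8 : n * ρ / lam ^ 2 * (18 * n ^ 3 * ρ ^ 2 / (kappa * delta * lam * s))
      = 18 * (n ^ 4 * ρ ^ 3 / (kappa * delta * lam ^ 3 * s)) := by
    field_simp
  have h9 : totalDrift m lam R (w * ρ) n P (4 * n / (s * delta))
      ≤ 18 * n ^ 3 * ρ ^ 2 / (kappa * delta * lam * s) + n * ρ * (4 * n / (s * delta)) := by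
    have h10 : 12 * n ^ 3 * ρ ^ 2 / (kappa * delta * lam * s)
        + 6 * n ^ 3 * ρ ^ 2 / (kappa * delta * lam * s)
        = 18 * n ^ 3 * ρ ^ 2 / (kappa * delta * lam * s) := by ring
    unfold totalDrift
    rw [← hs, ← hw, h2, mul_add, h1]
    linarith
  refine (mul_le_mul_of_nonneg_left h9 (by positivity)).trans ?_
  rw [mul_add, h8]
  linarith

/-- The width condition makes the drift of order `ε`. -/
theorem width_bound {m n lam kappa eps delta c₂ : ℝ} (hn : 1 ≤ n) (hc₂ : 0 < c₂)
    (hlam : 0 < lam) (hk0 : 0 < kappa) (he : 0 < eps) (hd0 : 0 < delta) (hm : 0 < m)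
    (h : c₂ * (n ^ 8 / (kappa ^ 2 * eps ^ 2 * delta ^ 4 * lam ^ 6)) ≤ m) :
    n ^ 4 / (kappa * delta * lam ^ 3 * Real.sqrt m) ≤ eps * delta / Real.sqrt c₂ := by
  have hc : 0 < Real.sqrt c₂ := Real.sqrt_pos.2 hc₂
  have hs : 0 < Real.sqrt m := Real.sqrt_pos.2 hm
  have hn0 : 0 < n := by linarith
  have h1 : Real.sqrt c₂ * (n ^ 4 / (kappa * eps * delta ^ 2 * lam ^ 3)) ≤ Real.sqrt m := by
    refine Real.le_sqrt_of_sq_le (le_trans (le_of_eq ?_) h)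
    rw [mul_pow, Real.sq_sqrt hc₂.le]
    congr 1
    field_simp
  rw [mul_div_assoc', div_le_iff₀ (by positivity)] at h1
  rw [div_le_div_iff₀ (by positivity) hc]
  calc n ^ 4 * Real.sqrt c₂ = Real.sqrt c₂ * n ^ 4 := mul_comm _ _
    _ ≤ Real.sqrt m * (kappa * eps * delta ^ 2 * lam ^ 3) := h1
    _ = eps * delta * (kappa * delta * lam ^ 3 * Real.sqrt m) := by ring

theorem rescale_cancel (n lam c₁ q eps t : ℝ) (hn : n ≠ 0) (hlam : lam ≠ 0) :
    n / lam * (c₁ * (q * lam * eps / n) * t) = c₁ * (t * q) * eps := by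
  field_simp

/-- Error times size of the predictions is of order `ε`. -/
theorem error_mul_size_le {n lam kappa eps delta c c₁ D τ H E B v : ℝ} (hn : 1 ≤ n)
    (hlam : 0 < lam) (hlam2 : lam ^ 2 ≤ n) (hk0 : 0 < kappa) (hk1 : kappa ≤ 1)
    (hτ1 : 1 ≤ τ) (hτ : τ ^ 2 * Real.sqrt delta = Real.sqrt c)
    (hkappa : kappa ≤ c₁ * (Real.sqrt delta * lam * eps / n)) (hH0 : 0 ≤ H)
    (hH : n * (1 + kappa * τ) / lam ^ 2 * H ≤ D)
    (hv0 : 0 ≤ v) (hv : v ≤ Real.sqrt n / Real.sqrt lam * (kappa * τ)) (hE0 : 0 ≤ E)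
    (hE : E ≤ v + (1 / Real.sqrt lam) * (Real.sqrt n * (kappa * τ) + H / lam) + H / lam)
    (hB : B ≤ v + Real.sqrt n * (1 + kappa * τ) / Real.sqrt lam
      + Real.sqrt n / Real.sqrt lam + 2) :
    E * B ≤ 16 * (c₁ * Real.sqrt c * eps) + 8 * D := by
  have hn0 : 0 < n := by linarith
  set w := Real.sqrt n with hw
  set l := Real.sqrt lam with hl
  have hw1 : 1 ≤ w := Real.one_le_sqrt.2 hn
  have hl0 : 0 < l := Real.sqrt_pos.2 hlam
  have hww : w ^ 2 = n := Real.sq_sqrt hn0.le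
  have hll : l ^ 2 = lam := Real.sq_sqrt hlam.le
  have hlw : lam ≤ w := Real.le_sqrt_of_sq_le hlam2
  have hlw' : l ≤ w := by
    exact Real.sqrt_le_sqrt (hlw.trans (by rw [← hww]; exact le_self_pow₀ hw1 two_ne_zero))
  set g := w / l with hg
  have hg1 : 1 ≤ g := (one_le_div hl0).2 hlw'
  set r := kappa * τ with hr
  have hr0 : 0 ≤ r := by positivity
  -- All terms are measured in g = √(n/λ); the constant 2 is absorbed because g ≥ 1.
  have hB' : B ≤ 4 * g * (1 + r) := by
    have e : w * (1 + r) / l = g * (1 + r) := by rw [hg]; ring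
    rw [e] at hB
    have h1 : 0 ≤ g * r := by positivity
    linarith [show 4 * g * (1 + r) = 4 * g + 4 * (g * r) by ring,
      show g * (1 + r) = g + g * r by ring]
  have hE' : E ≤ 2 * g * r + 2 * (w / l ^ 3 * H) := by
    have e1 : 1 / l * (w * r + H / lam) = g * r + 1 / l ^ 3 * H := by
      rw [hg, ← hll]; field_simp
    have e2 : H / lam = l / l ^ 3 * H := by rw [← hll]; field_simp
    rw [e1] at hE
    have e3 : 1 / l ^ 3 * H ≤ w / l ^ 3 * H := by gcongr
    have e4 : l / l ^ 3 * H ≤ w / l ^ 3 * H := by gcongr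
    rw [e2] at hE
    linarith
  have h1 : E * B ≤ (2 * g * r + 2 * (w / l ^ 3 * H)) * (4 * g * (1 + r)) :=
    (mul_le_mul_of_nonneg_left hB' hE0).trans
      (mul_le_mul_of_nonneg_right hE' (by positivity))
  have h2 : (2 * g * r + 2 * (w / l ^ 3 * H)) * (4 * g * (1 + r))
      = 8 * (n / lam * (r * (1 + r))) + 8 * (n * (1 + r) / lam ^ 2 * H) := by
    rw [hg, ← hww, ← hll]; field_simp; ring
  -- Both r and r² are at most κτ², by τ ≥ 1 and κ ≤ 1. This is the quantity that the bound on κ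
  -- controls, since τ²√δ is constant.
  have h3 : r * (1 + r) ≤ 2 * (kappa * τ ^ 2) := by
    have t1 : r ≤ kappa * τ ^ 2 := by
      rw [hr]
      exact mul_le_mul_of_nonneg_left (le_self_pow₀ hτ1 two_ne_zero) hk0.le
    have t2 : r ^ 2 ≤ kappa * τ ^ 2 := by
      rw [hr, mul_pow]
      exact mul_le_mul_of_nonneg_right (pow_le_of_le_one hk0.le hk1 two_ne_zero) (by positivity)
    linarith [show r * (1 + r) = r + r ^ 2 by ring]
  have h4 : n / lam * (kappa * τ ^ 2) ≤ c₁ * Real.sqrt c * eps := by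
    rw [← hτ]
    calc n / lam * (kappa * τ ^ 2)
        ≤ n / lam * (c₁ * (Real.sqrt delta * lam * eps / n) * τ ^ 2) := by gcongr
      _ = c₁ * (τ ^ 2 * Real.sqrt delta) * eps := by
        exact rescale_cancel _ _ _ _ _ _ hn0.ne' hlam.ne'
  have h5 : n / lam * (r * (1 + r)) ≤ n / lam * (2 * (kappa * τ ^ 2)) :=
    mul_le_mul_of_nonneg_left h3 (by positivity)
  rw [h2] at h1
  linarith

/-- Difference of squares: (u − t)² − (v − t)² = (u − v)(u + v − 2t). -/
theorem abs_influence_sub_le {p p' q q' t : ℝ} (ht : |t| ≤ 1) :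
    |influence p' p t - influence q' q t|
      ≤ (|p' - q'| * (|p'| + |q'| + 2) + |p - q| * (|p| + |q| + 2)) / 2 := by
  have key : ∀ u v : ℝ, |(u - t) ^ 2 - (v - t) ^ 2| ≤ |u - v| * (|u| + |v| + 2) := by
    intro u v
    rw [show (u - t) ^ 2 - (v - t) ^ 2 = (u - v) * (u + v - 2 * t) by ring, abs_mul]
    refine mul_le_mul_of_nonneg_left ?_ (abs_nonneg _)
    refine (abs_sub _ _).trans ?_
    rw [abs_mul, abs_two]
    linarith [abs_add_le u v]
  have e : influence p' p t - influence q' q t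
      = (((p' - t) ^ 2 - (q' - t) ^ 2) - ((p - t) ^ 2 - (q - t) ^ 2)) / 2 := by
    unfold influence; ring
  rw [e, abs_div, abs_two]
  have := abs_sub ((p' - t) ^ 2 - (q' - t) ^ 2) ((p - t) ^ 2 - (q - t) ^ 2)
  linarith [key p' q', key p q]

/-- There are n + 1 ≤ 2n points and the failure budget is δ/3, so 60000 = 2 · 3 · 10000. -/
theorem net_threshold_le {n kappa delta τ : ℝ} (hn : 1 ≤ n) (hd0 : 0 < delta)
    (hτ : τ ^ 4 = 60000 / delta) :
    (n + 1) * (10000 * kappa ^ 4) / (delta / 3) ≤ n * (kappa * τ) ^ 4 := by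
  have e : n * (kappa ^ 4 * (60000 / delta)) * (delta / 3) = 2 * n * (10000 * kappa ^ 4) := by
    field_simp
    ring
  rw [mul_pow, hτ, div_le_iff₀ (by positivity), e]
  exact mul_le_mul_of_nonneg_right (by linarith) (by positivity)

theorem flip_threshold_le {n kappa delta R P : ℝ} (hn : 1 ≤ n) (hd0 : 0 < delta)
    (hk0 : 0 < kappa) (hR0 : 0 ≤ R) (hP : P = 6 * n * R / (kappa * delta)) :
    (n + 1) * (R / kappa) / (delta / 3) ≤ P := by
  rw [hP]
  calc (n + 1) * (R / kappa) / (delta / 3) = 3 * (n + 1) * R / (kappa * delta) := by field_simp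
    _ ≤ 6 * n * R / (kappa * delta) :=
      div_le_div_of_nonneg_right (mul_le_mul_of_nonneg_right (by linarith) hR0) (by positivity)

/-- Here 3(n + 1)² ≤ 12n² ≤ 16n², and δ ≤ 1 weakens 1/δ to 1/δ² so that the threshold is a perfect
square. -/
theorem kernel_threshold_le {n m delta : ℝ} (hn : 1 ≤ n) (hd0 : 0 < delta) (hd1 : delta ≤ 1)
    (hm : 0 < m) :
    (n + 1) * (n + 1) * (1 / m) / (delta / 3) ≤ (4 * n / (Real.sqrt m * delta)) ^ 2 := by
  rw [div_pow, mul_pow, mul_pow, Real.sq_sqrt hm.le]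
  calc (n + 1) * (n + 1) * (1 / m) / (delta / 3)
      = 3 * (n + 1) ^ 2 * delta / (m * delta ^ 2) := by field_simp
    _ ≤ 4 ^ 2 * n ^ 2 / (m * delta ^ 2) := by
      refine div_le_div_of_nonneg_right ?_ (by positivity)
      have h1 : (n + 1) ^ 2 ≤ (2 * n) ^ 2 := by gcongr; linarith
      have h2 := mul_le_of_le_one_right (show 0 ≤ (n + 1) ^ 2 by positivity) hd1
      nlinarith

end Arithmetic

theorem sum_sq_le_of_sum_pow_four_le {ι : Type*} [Fintype ι] {v : ι → ℝ} {n r : ℝ}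
    (hn : (Fintype.card ι : ℝ) ≤ n) (h : ∑ j, v j ^ 4 ≤ n * r ^ 4) :
    ∑ j, v j ^ 2 ≤ (Real.sqrt n * r) ^ 2 := by
  have hn0 : 0 ≤ n := le_trans (by positivity) hn
  rw [mul_pow, Real.sq_sqrt hn0]
  have h1 := sq_sum_le_card_mul_sum_sq (s := (Finset.univ : Finset ι)) (f := fun j => v j ^ 2)
  simp only [← pow_mul, Finset.card_univ] at h1
  refine abs_le_of_sq_le_sq' (h1.trans ?_) (by positivity) |>.2
  calc (Fintype.card ι : ℝ) * ∑ j, v j ^ (2 * 2) ≤ n * (n * r ^ 4) :=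
        mul_le_mul hn h (Finset.sum_nonneg fun j _ => Even.pow_nonneg (by decide) (v j)) hn0
    _ = (n * r ^ 2) ^ 2 := by ring

theorem sum_sub_sq_le {ι : Type*} [Fintype ι] {y u : ι → ℝ} {n r : ℝ}
    (hn : (Fintype.card ι : ℝ) ≤ n) (hr : 0 ≤ r) (hy : ∀ j, |y j| ≤ 1)
    (hu : ∑ j, u j ^ 2 ≤ (Real.sqrt n * r) ^ 2) :
    ∑ j, (y j - u j) ^ 2 ≤ (Real.sqrt n * (1 + r)) ^ 2 := by
  have hn0 : 0 ≤ n := le_trans (by positivity) hn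
  have hy2 : ∑ j, y j ^ 2 ≤ Real.sqrt n ^ 2 := by
    rw [Real.sq_sqrt hn0]
    refine le_trans (Finset.sum_le_sum (g := fun _ => (1 : ℝ)) fun j _ => ?_) (by simpa using hn)
    rw [← sq_abs]
    exact pow_le_one₀ (abs_nonneg _) (hy j)
  have h1 : |∑ j, y j * u j| ≤ Real.sqrt n * (Real.sqrt n * r) := by
    have := Finset.sum_mul_sq_le_sq_mul_sq Finset.univ y u
    refine abs_le_of_sq_le_sq (this.trans ?_) (by positivity)
    rw [mul_pow]
    exact mul_le_mul hy2 hu (Finset.sum_nonneg fun _ _ => sq_nonneg _) (by positivity)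
  have e : ∑ j, (y j - u j) ^ 2 = ∑ j, y j ^ 2 - 2 * ∑ j, y j * u j + ∑ j, u j ^ 2 := by
    rw [Finset.mul_sum, ← Finset.sum_sub_distrib, ← Finset.sum_add_distrib]
    exact Finset.sum_congr rfl fun j _ => by ring
  rw [e]
  nlinarith [neg_le_of_abs_le h1]

/-- At a regular initialization the difference between the trained network and kernel ridge
regression, times the size of the two predictions, is of order `ε`. -/
theorem IsTrainedNetwork.error_mul_size_le {m d : ℕ} {ι : Type} [Fintype ι] [DecidableEq ι]
    {x : ι → EuclideanSpace ℝ (Fin d)} {y : ι → ℝ} {a : Fin m → ℝ} {W₀ : Weights m d}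
    {f : EuclideanSpace ℝ (Fin d) → ℝ} {n lam kappa eps delta c c₁ c₂ τ : ℝ}
    (h : IsTrainedNetwork x y lam a W₀ f) (hm : 0 < m)
    (ha : ∀ r, |a r| = 1) (hx : ∀ j, ‖x j‖ = 1) (hy : ∀ j, |y j| ≤ 1)
    (hn : 1 ≤ n) (hcard : (Fintype.card ι : ℝ) ≤ n) (hlam : 0 < lam) (hlam2 : lam ^ 2 ≤ n)
    (hk0 : 0 < kappa) (hk1 : kappa ≤ 1) (he : 0 < eps) (hd0 : 0 < delta)
    (hc₂ : 0 < c₂) (hτ1 : 1 ≤ τ) (hτ2 : τ ^ 2 * Real.sqrt delta = Real.sqrt c)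
    (hτ4 : τ ^ 4 * delta = c)
    (hkappa : kappa ≤ c₁ * (Real.sqrt delta * lam * eps / n))
    (hwidth : c₂ * (n ^ 8 / (kappa ^ 2 * eps ^ 2 * delta ^ 4 * lam ^ 6)) ≤ m)
    {R P : ℝ}
    (hR : R = 1 / Real.sqrt m * (Real.sqrt n * (Real.sqrt n * (1 + kappa * τ))) / lam)
    (hP : P = 6 * n * R / (kappa * delta))
    (hnet : ∑ j, network a W₀ (x j) ^ 4 ≤ n * (kappa * τ) ^ 4)
    (hflip : ∑ j, flipFraction W₀ R (x j) ≤ P)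
    (hker : ∑ j, ∑ k, (empKernel W₀ (x j) (x k) - ntk (x j) (x k)) ^ 2
      ≤ (4 * n / (Real.sqrt m * delta)) ^ 2)
    {z : EuclideanSpace ℝ (Fin d)} (hz : ‖z‖ = 1)
    (hnetz : network a W₀ z ^ 4 ≤ n * (kappa * τ) ^ 4) (hflipz : flipFraction W₀ R z ≤ P)
    (hkerz : ∑ k, (empKernel W₀ z (x k) - ntk z (x k)) ^ 2
      ≤ (4 * n / (Real.sqrt m * delta)) ^ 2) :
    |f z - ntkPredictor x y lam z| * (|f z| + |ntkPredictor x y lam z| + 2)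
      ≤ (16 * (c₁ * Real.sqrt c) + 1408 * (c / Real.sqrt c₂)) * eps := by
  have hm' : (0 : ℝ) < m := by exact_mod_cast hm
  have hn0 : 0 < n := by linarith
  have hr0 : 0 ≤ kappa * τ := by positivity
  have hlamn : lam ≤ n := by
    by_contra! hlt
    nlinarith [mul_lt_mul'' hlt hlt hn0.le hn0.le]
  have hU := sum_sq_le_of_sum_pow_four_le hcard hnet
  have hS := sum_sub_sq_le hcard hr0 hy hU
  have hE := h.abs_sub_ntkPredictor_le hm ha hx hlam (R := R) (by positivity) (by positivity)
    (by positivity) hn hcard hS hR.ge hU hflip hker hz hflipz hkerz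
  have hB1 := h.abs_le ha hlam (by positivity) hS hz
  have hB2 := abs_ntkPredictor_le (x := x) hlam hy hcard hz
  have hR0 : 0 ≤ R := by rw [hR]; positivity
  have hP0 : 0 ≤ P := by rw [hP]; positivity
  have hH0 : 0 ≤ totalDrift m lam R (Real.sqrt n * (1 + kappa * τ)) n P
      (4 * n / (Real.sqrt m * delta)) := by
    unfold totalDrift; positivity
  have hτk : 1 + kappa * τ ≤ 2 * τ := by nlinarith
  have hD : 22 * (n ^ 4 * (1 + kappa * τ) ^ 3 / (kappa * delta * lam ^ 3 * Real.sqrt m))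
      ≤ 176 * (c / Real.sqrt c₂) * eps := by
    have h1 := width_bound hn hc₂ hlam hk0 he hd0 hm' hwidth
    -- One spare power of τ is given away, so that τ⁴δ = c cancels the remaining δ.
    have h2 : (1 + kappa * τ) ^ 3 ≤ 8 * τ ^ 4 := by
      calc (1 + kappa * τ) ^ 3 ≤ (2 * τ) ^ 3 := by gcongr
        _ = 8 * τ ^ 3 := by ring
        _ ≤ 8 * τ ^ 4 := by
          have := pow_le_pow_right₀ hτ1 (show 3 ≤ 4 by norm_num)
          linarith
    calc 22 * (n ^ 4 * (1 + kappa * τ) ^ 3 / (kappa * delta * lam ^ 3 * Real.sqrt m))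
        = 22 * ((1 + kappa * τ) ^ 3 * (n ^ 4 / (kappa * delta * lam ^ 3 * Real.sqrt m))) := by
          ring
      _ ≤ 22 * ((8 * τ ^ 4) * (eps * delta / Real.sqrt c₂)) := by gcongr
      _ = 176 * (c / Real.sqrt c₂) * eps := by rw [← hτ4]; ring
  -- The fourth-power bound gives n^{1/4}κτ, and λ² ≤ n turns n^{1/4} into at most √(n/λ).
  have hv : |network a W₀ z| ≤ Real.sqrt n / Real.sqrt lam * (kappa * τ) := by
    refine le_of_pow_le_pow_left₀ four_ne_zero (by positivity) ?_
    rw [show |network a W₀ z| ^ 4 = network a W₀ z ^ 4 from Even.pow_abs (by decide) _, mul_pow]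
    refine hnetz.trans (mul_le_mul_of_nonneg_right ?_ (by positivity))
    rw [div_pow, show Real.sqrt n ^ 4 = (Real.sqrt n ^ 2) ^ 2 by ring,
      show Real.sqrt lam ^ 4 = (Real.sqrt lam ^ 2) ^ 2 by ring, Real.sq_sqrt hn0.le,
      Real.sq_sqrt hlam.le, le_div_iff₀ (by positivity), sq n]
    exact mul_le_mul_of_nonneg_left hlam2 hn0.le
  have := WideReLU.error_mul_size_le (E := |f z - ntkPredictor x y lam z|)
    (B := |f z| + |ntkPredictor x y lam z| + 2) hn hlam hlam2 hk0 hk1 hτ1 hτ2 hkappa hH0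
    ((totalDrift_scaled_le hm hn hlam hlamn hk0 hk1 hd0 (by linarith) hR hP).trans hD)
    (abs_nonneg _) hv (abs_nonneg _) hE (by linarith)
  refine this.trans (le_of_eq ?_)
  ring

end WideReLU

/-! ### Assembly for the full and the leave-one-out data. -/

theorem theorem2 (c₁ c₂ C : ℝ) (hc₁ : 0 < c₁) (hc₂ : 0 < c₂) (hC : 0 < C) :
    ∃ K : ℝ, 0 < K ∧
      ∀ (n d m : ℕ) (x : Fin n → EuclideanSpace ℝ (Fin d)) (y : Fin n → ℝ)
        (lam kappa eps delta : ℝ),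
        (∀ i, ‖x i‖ = 1) → (∀ i, |y i| ≤ 1) →
        0 < lam → lam < Real.sqrt n →
        0 < eps → 0 < delta → delta < 1 →
        0 < kappa → kappa ≤ 1 →
        kappa ≤ c₁ * (Real.sqrt delta * lam * eps / n) →
        c₂ * ((n : ℝ) ^ 8 / (kappa ^ 2 * eps ^ 2 * delta ^ 4 * lam ^ 6)) ≤ m →
        (∀ z : EuclideanSpace ℝ (Fin d), ‖z‖ = 1 → |WideReLU.ntkPredictor x y lam z| < C) →
        ∀ (i : Fin n) (xte : EuclideanSpace ℝ (Fin d)) (yte : ℝ), ‖xte‖ = 1 → |yte| ≤ 1 →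
          ∃ G : Set ((Fin m → ℝ) × WideReLU.Weights m d), MeasurableSet G ∧
            ENNReal.ofReal (1 - delta) ≤ WideReLU.initLaw m d kappa G ∧
            ∀ θ ∈ G, ∀ fnn fnnLoo : EuclideanSpace ℝ (Fin d) → ℝ,
              WideReLU.IsTrainedNetwork x y lam θ.1 θ.2 fnn →
              WideReLU.IsTrainedNetwork (WideReLU.leaveOut i x) (WideReLU.leaveOut i y) lam
                θ.1 θ.2 fnnLoo →
              (∀ z : EuclideanSpace ℝ (Fin d), ‖z‖ = 1 → |fnn z| < C) →
              |WideReLU.influence (fnnLoo xte) (fnn xte) yte -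
                WideReLU.influence
                  (WideReLU.ntkPredictor (WideReLU.leaveOut i x) (WideReLU.leaveOut i y) lam xte)
                  (WideReLU.ntkPredictor x y lam xte) yte| ≤ K * eps := by
  -- Here 1408 = 8 · 22 · 8. Full and leave-one-out data each contribute this bound, and the factor
  -- 1/2 in the influence averages the two.
  refine ⟨16 * (c₁ * Real.sqrt 60000) + 1408 * (60000 / Real.sqrt c₂), by positivity, ?_⟩
  intro n d m x y lam kappa eps delta hx hy hlam hlamn he hd0 hd1 hk0 hk1 hkappa hwidth _
    i xte yte hxte hyte
  have hn : (1 : ℝ) ≤ n := by exact_mod_cast i.pos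
  have hm' : (0 : ℝ) < m := lt_of_lt_of_le (by positivity) hwidth
  have hm : 0 < m := by exact_mod_cast hm'
  have hlam2 : lam ^ 2 ≤ n := by
    rw [← Real.sq_sqrt (show (0 : ℝ) ≤ n by positivity)]
    exact pow_le_pow_left₀ hlam.le hlamn.le 2
  -- A fourth root, because Markov's inequality is applied to fourth powers: κτ is the scale of the
  -- initial outputs on the good event.
  set τ : ℝ := Real.sqrt (Real.sqrt (60000 / delta)) with hτ
  have hτsq : τ ^ 2 = Real.sqrt (60000 / delta) := Real.sq_sqrt (Real.sqrt_nonneg _)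
  have hτ1 : 1 ≤ τ := by
    rw [hτ, Real.one_le_sqrt, Real.one_le_sqrt, one_le_div hd0]
    linarith
  have hτ2 : τ ^ 2 * Real.sqrt delta = Real.sqrt 60000 := by
    rw [hτsq, ← Real.sqrt_mul (by positivity), div_mul_cancel₀ _ hd0.ne']
  have hτ4' : τ ^ 4 = 60000 / delta := by
    rw [show τ ^ 4 = (τ ^ 2) ^ 2 by ring, hτsq, Real.sq_sqrt (by positivity)]
  have hτ4 : τ ^ 4 * delta = 60000 := by
    rw [hτ4', div_mul_cancel₀ _ hd0.ne']
  obtain ⟨R, hR⟩ : ∃ R,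
      R = 1 / Real.sqrt m * (Real.sqrt n * (Real.sqrt n * (1 + kappa * τ))) / lam :=
    ⟨_, rfl⟩
  obtain ⟨P, hP⟩ : ∃ P, P = 6 * n * R / (kappa * delta) := ⟨_, rfl⟩
  have hR0 : 0 < R := by
    rw [hR]
    have : 0 < Real.sqrt m := Real.sqrt_pos.2 hm'
    have : 0 < Real.sqrt n := Real.sqrt_pos.2 (by linarith)
    have : 0 < τ := by linarith
    positivity
  -- `none` stands for the test point, so one event covers training points, test point and all
  -- kernel entries between them.
  obtain ⟨G, hGm, hGp, hG⟩ := WideReLU.exists_good_event (J := Option (Fin n)) hm hk0 hd0 hR0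
    (fun o => o.elim xte x) (by rintro (_ | j) <;> simp [hxte, hx])
  refine ⟨G, hGm, hGp, fun θ hθ fnn fnnLoo hfnn hfnnLoo _ => ?_⟩
  obtain ⟨ha, hnet, hflip, hker⟩ := hG θ hθ
  have hcard : (Fintype.card (Option (Fin n)) : ℝ) = n + 1 := by simp
  rw [hcard, Fintype.sum_option] at hnet hflip
  rw [Fintype.card_prod, Nat.cast_mul, hcard, Fintype.sum_prod_type, Fintype.sum_option] at hker
  simp only [Fintype.sum_option, Option.elim] at hnet hflip hker
  have hnet' := WideReLU.net_threshold_le hn hd0 (kappa := kappa) hτ4'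
  have hflip' := WideReLU.flip_threshold_le hn hd0 hk0 hR0.le hP
  have hker' := WideReLU.kernel_threshold_le hn hd0 hd1.le hm'
  have s1 : ∀ j, 0 ≤ WideReLU.network θ.1 θ.2 (x j) ^ 4 := fun j => by positivity
  have s2 : ∀ j, 0 ≤ WideReLU.flipFraction θ.2 R (x j) := fun j =>
    WideReLU.flipFraction_nonneg _ _ _
  have s3 : ∀ u v, 0 ≤ (WideReLU.empKernel θ.2 u v - WideReLU.ntk u v) ^ 2 := fun u v =>
    sq_nonneg _
  have t1 : ∑ j, WideReLU.network θ.1 θ.2 (x j) ^ 4 ≤ n * (kappa * τ) ^ 4 := by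
    have : 0 ≤ WideReLU.network θ.1 θ.2 xte ^ 4 := by positivity
    linarith
  have t1z : WideReLU.network θ.1 θ.2 xte ^ 4 ≤ n * (kappa * τ) ^ 4 := by
    linarith [Finset.sum_nonneg fun j (_ : j ∈ Finset.univ) => s1 j]
  have t2 : ∑ j, WideReLU.flipFraction θ.2 R (x j) ≤ P := by
    linarith [WideReLU.flipFraction_nonneg θ.2 R xte]
  have t2z : WideReLU.flipFraction θ.2 R xte ≤ P := by
    linarith [Finset.sum_nonneg fun j (_ : j ∈ Finset.univ) => s2 j]
  rw [Finset.sum_add_distrib] at hker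
  have k0 := s3 xte xte
  have k1 := Finset.sum_nonneg fun j (_ : j ∈ Finset.univ) => s3 xte (x j)
  have k2 := Finset.sum_nonneg fun j (_ : j ∈ Finset.univ) => s3 (x j) xte
  have k3 := Finset.sum_nonneg fun j (_ : j ∈ Finset.univ) =>
    Finset.sum_nonneg fun k (_ : k ∈ Finset.univ) => s3 (x j) (x k)
  have t3 : ∑ j, ∑ k, (WideReLU.empKernel θ.2 (x j) (x k) - WideReLU.ntk (x j) (x k)) ^ 2
      ≤ (4 * n / (Real.sqrt m * delta)) ^ 2 := by linarith
  have t3z : ∑ k, (WideReLU.empKernel θ.2 xte (x k) - WideReLU.ntk xte (x k)) ^ 2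
      ≤ (4 * n / (Real.sqrt m * delta)) ^ 2 := by linarith
  -- Every regularity condition is an upper bound on a sum of nonnegative terms, so it survives
  -- removal of a point: the same event and thresholds serve the reduced data.
  have hsub : ∀ f : Fin n → ℝ, (∀ j, 0 ≤ f j) → ∑ j : {j : Fin n // j ≠ i}, f j ≤ ∑ j, f j := by
    intro f hf
    rw [← Finset.sum_subtype (Finset.univ.filter (· ≠ i)) (by simp) f]
    exact Finset.sum_le_sum_of_subset_of_nonneg (Finset.filter_subset _ _) fun j _ _ => hf j
  have full := hfnn.error_mul_size_le (z := xte) hm ha hx hy hn (by simp) hlam hlam2 hk0 hk1 he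
    hd0 hc₂ hτ1 hτ2 hτ4 hkappa hwidth hR hP t1 t2 t3 hxte t1z t2z t3z
  have hcardLoo : (Fintype.card {j : Fin n // j ≠ i} : ℝ) ≤ n := by
    exact_mod_cast (Fintype.card_subtype_le _).trans (by simp)
  have t3Loo : ∑ j : {j : Fin n // j ≠ i}, ∑ k : {j : Fin n // j ≠ i},
      (WideReLU.empKernel θ.2 (x j) (x k) - WideReLU.ntk (x j) (x k)) ^ 2
      ≤ (4 * n / (Real.sqrt m * delta)) ^ 2 :=
    (Finset.sum_le_sum fun (j : {j : Fin n // j ≠ i}) _ =>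
      hsub _ fun k => s3 (x j) (x k)).trans
      ((hsub (fun j => ∑ k, (WideReLU.empKernel θ.2 (x j) (x k) - WideReLU.ntk (x j) (x k)) ^ 2)
        fun j => Finset.sum_nonneg fun k _ => s3 (x j) (x k)).trans t3)
  have loo := hfnnLoo.error_mul_size_le (z := xte) hm ha (fun j => hx j) (fun j => hy j) hn
    hcardLoo hlam hlam2 hk0 hk1 he hd0 hc₂ hτ1 hτ2 hτ4 hkappa hwidth hR hP
    ((hsub _ s1).trans t1) ((hsub _ s2).trans t2) t3Loo hxte t1z t2z ((hsub _ fun k => s3 xte (x k)).trans t3z)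
  refine (WideReLU.abs_influence_sub_le hyte).trans ?_
  linarith
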